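/- Let $G=(V,E)$ be a graph, $C=\{c_1,\dots,c_k\}$ a set of colors and $c$ a coloring of the edges, where $c(e)\in C$ for every edge $e$. Vertices $u,v$ are \emph{$c_i$-avoiding edge-connected} if they lie in the same connected component of the graph that remains after all edges of color $c_i$ are removed, and \emph{color-avoiding edge-connected} if this holds for every $i\in\{1,\dots,k\}$. This is an equivalence relation on $V$; its classes are called the \emph{color-avoiding edge-connected components} of $G$. The following decision problem, \textsc{ColorAvoidingEdgeConnectedComponent}, is in P. Instance: a finite simple graph $G$, a finite color set $C$, a function $c:E(G)\to C$ and a positive integer $l$. Question: does $G$ have a color-avoiding edge-connected component of size at least $l$? Moreover, the list of all color-avoiding edge-connected components of $G$ can be computed in polynomial time. The same statements hold if $G$ may have multiple edges, and also if every edge $e$ carries a set (list) of colors $c(e)\subseteq C$, where the removal of $c_i$ then deletes every edge $e$ with $c_i\in c(e)$, and also if both are allowed. Here running times are those of multi-stack Turing machines, as a function of the length of the input word; the numbers of vertices and colors are written in unary (equivalently, up to polynomial factors, vertices and colors are listed one by one), followed by the list of edges with the names of their ends and of their colors (written in unary), and $l$ is written in binary. Membership of a problem in P means that the language of the words of its yes-instances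 is decided in polynomial time on all words over the alphabet. -/

import Mathlib

namespace ColorAvoiding

/-! ### Edge-colored graphs -/

/-- An undirected multigraph with vertex set `V` and edge set `E` in which every edge `e` has two
ends `ends e` and carries a set `colors e ⊆ C` of colors.  An edge with one color `c e` has
`colors e = {c e}`; a graph without multiple edges is the case of an injective `ends`. -/
structure ColoredGraph (V E C : Type*) where
  ends : E → Sym2 V
  colors : E → Set C

namespace ColoredGraph

variable {V E C : Type*}

/-- Adjacency after the removal of all edges that carry the color `i`. -/
def remaining (G : ColoredGraph V E C) (i : C) : SimpleGraph V where
  Adj u v := u ≠ v ∧ ∃ e : E, G.ends e = s(u, v) ∧ i ∉ G.colors e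
  symm := ⟨fun u v h => ⟨h.1.symm, by
    obtain ⟨e, he, hi⟩ := h.2
    exact ⟨e, he.trans Sym2.eq_swap, hi⟩⟩⟩
  loopless := ⟨fun _ h => h.1 rfl⟩

/-- `u` and `v` are `i`-avoiding edge-connected: after the removal of the edges that carry the
color `i` they are in the same connected component. -/
def AvoidingConnected (G : ColoredGraph V E C) (i : C) (u v : V) : Prop :=
  (G.remaining i).Reachable u v

/-- `u` and `v` are color-avoiding edge-connected. -/
def ColorAvoidingConnected (G : ColoredGraph V E C) (u v : V) : Prop :=
  ∀ i : C, G.AvoidingConnected i u v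

/-- The color-avoiding edge-connected components: the classes of the relation
`ColorAvoidingConnected`. -/
def IsComponent (G : ColoredGraph V E C) (S : Set V) : Prop :=
  ∃ v : V, S = {u | G.ColorAvoidingConnected v u}

end ColoredGraph

/-! ### Finite edge-colored graphs as inputs of an algorithm -/

/-- A finite edge-colored graph given explicitly: vertices `0, …, n - 1`, colors `0, …, k - 1`, and
a list of edges, each with its two ends and its list of colors. -/
structure EdgeList where
  n : ℕ
  k : ℕ
  edges : List (Fin n × Fin n × List (Fin k))

namespace EdgeList

/-- The edge-colored graph that an edge list describes (edges are the positions in the list). -/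
def graph (I : EdgeList) : ColoredGraph (Fin I.n) (Fin I.edges.length) (Fin I.k) where
  ends j := s((I.edges.get j).1, (I.edges.get j).2.1)
  colors j := {i | i ∈ (I.edges.get j).2.2}

/-- No edge is a loop. -/
def Loopless (I : EdgeList) : Prop :=
  ∀ j, ¬ (I.graph.ends j).IsDiag

/-- The graph is simple: no loops and no multiple edges. -/
def Simple (I : EdgeList) : Prop :=
  I.Loopless ∧ Function.Injective I.graph.ends

/-- Every edge has exactly one color. -/
def SingleColored (I : EdgeList) : Prop :=
  ∀ e ∈ I.edges, ∃ c, e.2.2 = [c]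

/-- The lists in `L` are the color-avoiding edge-connected components of the graph, each component
listed once and each of its vertices listed once. -/
def ListsComponents (I : EdgeList) (L : List (List (Fin I.n))) : Prop :=
  L.flatten.Nodup ∧ ∀ S : Set (Fin I.n), I.graph.IsComponent S ↔ ∃ l ∈ L, {v | v ∈ l} = S

end EdgeList

/-! ### Encoding as words -/

/-- The alphabet. -/
inductive Symbol
  | zero
  | one
  | comma
  | semicolon
  deriving DecidableEq

/-- A natural number in unary.  It is used for the numbers `n`, `k` of vertices and colors (which
are thus at most the length of the input, as when vertices and colors are listed one by one) and for
the names of vertices and colors, which are smaller than `n` and `k`. -/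
def unary (m : ℕ) : List Symbol :=
  List.replicate m Symbol.one

/-- A natural number in binary, least significant digit first. -/
def binary (m : ℕ) : List Symbol :=
  m.bits.map fun b => if b then Symbol.one else Symbol.zero

/-- The word `u,v,c₁,…,cᵣ;` of an edge. -/
def encodeEdge {n k : ℕ} (e : Fin n × Fin n × List (Fin k)) : List Symbol :=
  unary e.1 ++ Symbol.comma :: unary e.2.1 ++
    (e.2.2.flatMap fun c => Symbol.comma :: unary c) ++ [Symbol.semicolon]

/-- The word of an edge-colored graph: `n;k;` followed by the words of the edges. -/
def encodeGraph (I : EdgeList) : List Symbol :=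
  unary I.n ++ Symbol.semicolon :: unary I.k ++ Symbol.semicolon :: I.edges.flatMap encodeEdge

/-- The word of an edge-colored graph together with a natural number `l` in binary. -/
def encodeInstance (I : EdgeList) (l : ℕ) : List Symbol :=
  binary l ++ Symbol.semicolon :: encodeGraph I

/-- The word of a list of lists of numbers: each number is followed by a comma, each inner list
by a semicolon. -/
def encodeLists (L : List (List ℕ)) : List Symbol :=
  L.flatMap fun l => (l.flatMap fun v => unary v ++ [Symbol.comma]) ++ [Symbol.semicolon]

/-! ### Polynomial time -/

/-- `f` is computed in polynomial time by a Turing machine with finitely many stacks. -/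
def PolyTimeComputable {α β αΓ βΓ : Type} (ea : α → List αΓ) (eb : β → List βΓ) (f : α → β) :
    Prop :=
  Nonempty (Turing.TM2ComputableInPolyTime ea eb f)

open Classical in
/-- The class P: membership in the language `L` is decided, on every word over the alphabet, by a
Turing machine in time polynomial in the length of the word. -/
def InP {A : Type} (L : Language A) : Prop :=
  PolyTimeComputable (fun w : List A => w) Computability.encodeBool (fun w => decide (w ∈ L))

/-! ### The decision problem -/

/-- The decision problem whose instances are an edge-colored graph from the class `Admissible` and a
positive integer `l`, and whose question is whether the graph has a color-avoiding edge-connected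
component of size at least `l`; as the language of the words of its yes-instances. -/
def componentProblem (Admissible : EdgeList → Prop) : Language Symbol :=
  {w | ∃ (I : EdgeList) (l : ℕ), Admissible I ∧ 0 < l ∧ w = encodeInstance I l ∧
    ∃ S : Set (Fin I.n), I.graph.IsComponent S ∧ l ≤ S.ncard}

/-- The problem for simple graphs with one color on every edge. -/
def ColorAvoidingEdgeConnectedComponent : Language Symbol :=
  componentProblem fun I => I.Simple ∧ I.SingleColored

/-- The problem for graphs with multiple edges and one color on every edge. -/
def ColorAvoidingEdgeConnectedComponentMultigraph : Language Symbol :=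
  componentProblem fun I => I.Loopless ∧ I.SingleColored

/-- The problem for simple graphs with a list of colors on every edge. -/
def ColorAvoidingEdgeConnectedComponentLists : Language Symbol :=
  componentProblem fun I => I.Simple

/-- The problem for graphs with multiple edges and a list of colors on every edge. -/
def ColorAvoidingEdgeConnectedComponentMultigraphLists : Language Symbol :=
  componentProblem fun I => I.Loopless

end ColorAvoiding

namespace ColorAvoiding

open Turing

/-! ### Program fragments of stack machines -/

/-! For a fixed color, a search through the edges that survive its removal finds all vertices
reachable from a given one; `n` rounds suffice because a path has fewer than `n` edges
(`EdgeList.mem_reach`). Repeating this for every color decides color-avoiding connectivity. As this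
is an equivalence relation, each class is listed exactly once if it is produced from its least
vertex (`EdgeList.listsComponents_components`). Parallel edges and color lists do not affect the
search, so the four decision problems differ only in an easy test of admissibility.

Words that encode nothing are rejected by parsing, encoding the result again and comparing it with
the input (`accepts_iff`). The number `l` is binary and may be exponentially large, but no component
has more than `n` vertices, so its value is only computed up to `n + 1`.

The rest of the work is to obtain actual Turing machines. Data are binary trees, written in Polish
notation on one stack, and `PolyFun` is the class of functions that a program fragment computes on
the top tree in polynomial time. It is closed under composition, pairing, case distinction and
folds. A fold needs a polynomial bound on all its intermediate states (`PolyFun.list_foldl`), since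
iterating a polynomial-time step could otherwise produce exponentially large data. The algorithm is
composed from these operations, and `PolyFun.polyTimeComputable` and `PolyFun.inP` turn the
fragments into machines that work on words. -/

instance : Fintype Symbol :=
  ⟨{.zero, .one, .comma, .semicolon}, fun x => by cases x <;> simp⟩

/-- Binary trees, the data on which the programs operate. -/
inductive BinTree
  | leaf
  | node (l r : BinTree)

namespace BinTree

/-- The word of a tree in Polish notation. -/
def word : BinTree → List Bool
  | leaf => [false]
  | node l r => true :: (word l ++ word r)

/-- The length of the word of a tree. -/
def size (t : BinTree) : ℕ := t.word.length

@[simp] theorem size_leaf : leaf.size = 1 := rfl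

@[simp] theorem size_node (l r : BinTree) : (node l r).size = l.size + r.size + 1 := by
  simp [size, word]

end BinTree

/-- The stacks of bits. -/
inductive WorkStack
  | main
  | left
  | right
  | count
  deriving DecidableEq

instance : Fintype WorkStack :=
  ⟨{.main, .left, .right, .count}, fun x => by cases x <;> simp⟩

/-- The stack `none` holds symbols, it is used for input and output. -/
abbrev Alphabet : Option WorkStack → Type
  | none => Symbol
  | some _ => Bool

/-- The finite memory. -/
abbrev Register := Symbol × Bool

/-- The contents of the stacks. -/
abbrev Store := ∀ k, List (Alphabet k)

/-- The store with given contents. -/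
def store (io : List Symbol) (m l r c : List Bool) : Store
  | none => io
  | some .main => m
  | some .left => l
  | some .right => r
  | some .count => c

section store
variable (io : List Symbol) (m l r c : List Bool)

@[simp] theorem store_io : store io m l r c none = io := rfl
@[simp] theorem store_main : store io m l r c (some .main) = m := rfl
@[simp] theorem store_left : store io m l r c (some .left) = l := rfl
@[simp] theorem store_right : store io m l r c (some .right) = r := rfl
@[simp] theorem store_count : store io m l r c (some .count) = c := rfl

@[simp] theorem update_io (x : List Symbol) :
    Function.update (store io m l r c) none x = store x m l r c := by
  funext k; rcases k with _ | _ | _ | _ | _ <;> rfl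
@[simp] theorem update_main (x : List Bool) :
    Function.update (store io m l r c) (some .main) x = store io x l r c := by
  funext k; rcases k with _ | _ | _ | _ | _ <;> rfl
@[simp] theorem update_left (x : List Bool) :
    Function.update (store io m l r c) (some .left) x = store io m x r c := by
  funext k; rcases k with _ | _ | _ | _ | _ <;> rfl
@[simp] theorem update_right (x : List Bool) :
    Function.update (store io m l r c) (some .right) x = store io m l x c := by
  funext k; rcases k with _ | _ | _ | _ | _ <;> rfl
@[simp] theorem update_count (x : List Bool) :
    Function.update (store io m l r c) (some .count) x = store io m l r x := by
  funext k; rcases k with _ | _ | _ | _ | _ <;> rfl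

end store

/-- Statements with labels in `Λ`. -/
abbrev Stmt (Λ : Type) := TM2.Stmt Alphabet Λ Register

/-- Renaming of the labels in a statement. -/
def relabel {Λ Λ' : Type} (φ : Λ → Λ') : Stmt Λ → Stmt Λ'
  | .push k f q => .push k f (relabel φ q)
  | .peek k f q => .peek k f (relabel φ q)
  | .pop k f q => .pop k f (relabel φ q)
  | .load f q => .load f (relabel φ q)
  | .branch f q q' => .branch f (relabel φ q) (relabel φ q')
  | .goto f => .goto fun v => φ (f v)
  | .halt => .halt

theorem stepAux_relabel {Λ Λ' : Type} (φ : Λ → Λ') (q : Stmt Λ) (v : Register) (S : Store) :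
    TM2.stepAux (relabel φ q) v S =
      ⟨(TM2.stepAux q v S).l.map φ, (TM2.stepAux q v S).var, (TM2.stepAux q v S).stk⟩ := by
  induction q generalizing v S with
  | branch f q q' h h' =>
    simp only [relabel, TM2.stepAux]
    cases f v <;> simp [h, h']
  | goto f => simp [relabel]
  | halt => simp [relabel]
  | _ => simp only [relabel, TM2.stepAux, *]

/-- A program fragment: a machine with an entry, that is left by a jump to `none`. -/
structure Frag where
  Label : Type
  [fin : Fintype Label]
  entry : Label
  code : Label → Stmt (Option Label)

attribute [instance] Frag.fin

/-- `Run M l v S v' S' t`: the code `M`, started at the label `l`, is left within `t` steps. -/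
inductive Run {Λ : Type} (M : Λ → Stmt (Option Λ)) :
    Option Λ → Register → Store → Register → Store → ℕ → Prop
  | exit (v S t) : Run M none v S v S t
  | step {l v S l' v₁ S₁ v' S' t} (h : TM2.stepAux (M l) v S = ⟨some l', v₁, S₁⟩)
      (h' : Run M l' v₁ S₁ v' S' t) : Run M (some l) v S v' S' (t + 1)

/-- The exit is allowed with any remaining budget, so the number in `Run` is an upper bound and not
an exact count. -/
theorem Run.mono {Λ : Type} {M : Λ → Stmt (Option Λ)} {l v S v' S' t} (h : Run M l v S v' S' t)
    {t' : ℕ} (ht : t ≤ t') : Run M l v S v' S' t' := by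
  induction h generalizing t' with
  | exit => exact .exit _ _ _
  | step h _ ih =>
    obtain ⟨u, rfl⟩ : ∃ u, t' = u + 1 := ⟨t' - 1, by omega⟩
    exact .step h (ih (by omega))

/-- A run inside code that is part of other code. -/
theorem Run.embed {Λ Λ' : Type} {M : Λ → Stmt (Option Λ)} {M' : Λ' → Stmt (Option Λ')}
    (φ : Λ → Λ') (k : Option Λ')
    (hφ : ∀ l, M' (φ l) = relabel (fun o => o.elim k fun l => some (φ l)) (M l))
    {l v S v₁ S₁ v' S' t t'} (h : Run M l v S v₁ S₁ t) (h' : Run M' k v₁ S₁ v' S' t') :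
    Run M' (l.elim k fun l => some (φ l)) v S v' S' (t + t') := by
  induction h with
  | exit => exact h'.mono (Nat.le_add_left _ _)
  | @step l v S l' v₁ S₁ v' S' t hs _ ih =>
    rw [Nat.add_right_comm]
    refine .step (l' := l'.elim k fun l => some (φ l)) ?_ (ih h')
    rw [hφ, stepAux_relabel, hs]
    rfl

namespace Frag

/-- The fragment `F` transforms the store `S` into `S'` within `t` steps. -/
def Exec (F : Frag) (S S' : Store) (t : ℕ) : Prop :=
  ∀ v, ∃ v', Run F.code (some F.entry) v S v' S' t

theorem Exec.mono {F : Frag} {S S' : Store} {t t' : ℕ} (h : F.Exec S S' t) (ht : t ≤ t') :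
    F.Exec S S' t' := fun v =>
  let ⟨v', h'⟩ := h v
  ⟨v', h'.mono ht⟩

/-- A single statement. -/
def block (q : Stmt (Option Unit)) : Frag where
  Label := Unit
  entry := ()
  code _ := q

theorem exec_block {q : Stmt (Option Unit)} {S S' : Store}
    (h : ∀ v, ∃ v', TM2.stepAux q v S = ⟨some none, v', S'⟩) : (block q).Exec S S' 1 := fun v =>
  let ⟨v', h'⟩ := h v
  ⟨v', .step h' (.exit _ _ 0)⟩

/-- Sequential composition. -/
def seq (F G : Frag) : Frag where
  Label := F.Label ⊕ G.Label
  entry := .inl F.entry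
  code
    | .inl l => relabel (fun o => o.elim (some (.inr G.entry)) fun l => some (.inl l)) (F.code l)
    | .inr l => relabel (fun o => o.elim none fun l => some (.inr l)) (G.code l)

/-- The exit of `F` is redirected to the entry of `G`. Nothing is known about the register that `F`
leaves behind, which is why `Exec` quantifies over all initial registers. -/
theorem exec_seq {F G : Frag} {S S₁ S' : Store} {t t' : ℕ} (h : F.Exec S S₁ t)
    (h' : G.Exec S₁ S' t') : (seq F G).Exec S S' (t + t') := fun v => by
  obtain ⟨v₁, h₁⟩ := h v
  obtain ⟨v', h₂⟩ := h' v₁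
  have h₃ := Run.embed (M' := (seq F G).code) Sum.inr none (fun _ => rfl) h₂ (.exit v' S' 0)
  exact ⟨v', Run.embed (M' := (seq F G).code) Sum.inl _ (fun _ => rfl) h₁ h₃⟩

/-- Case distinction by the head of a stack. -/
def ite (k : Option WorkStack) (p : Option (Alphabet k) → Bool) (F G : Frag) : Frag where
  Label := Option (F.Label ⊕ G.Label)
  entry := none
  code
    | none => .peek k (fun v s => (v.1, p s)) (.branch (fun v => v.2)
        (.goto fun _ => some (some (.inl F.entry))) (.goto fun _ => some (some (.inr G.entry))))
    | some (.inl l) => relabel (fun o => o.elim none fun l => some (some (.inl l))) (F.code l)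
    | some (.inr l) => relabel (fun o => o.elim none fun l => some (some (.inr l))) (G.code l)

theorem exec_ite_true {k : Option WorkStack} {p : Option (Alphabet k) → Bool} {F G : Frag}
    {S S' : Store} {t : ℕ} (hp : p (S k).head? = true) (h : F.Exec S S' t) :
    (ite k p F G).Exec S S' (t + 1) := fun v => by
  obtain ⟨v', h₁⟩ := h (v.1, true)
  refine ⟨v', .step (l' := some (some (.inl F.entry))) (v₁ := (v.1, true)) (S₁ := S)
    (by simp [ite, hp]) ?_⟩
  exact Run.embed (M' := (ite k p F G).code) (fun l => some (.inl l)) none (fun _ => rfl) h₁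
    (.exit v' S' 0)

theorem exec_ite_false {k : Option WorkStack} {p : Option (Alphabet k) → Bool} {F G : Frag}
    {S S' : Store} {t : ℕ} (hp : p (S k).head? = false) (h : G.Exec S S' t) :
    (ite k p F G).Exec S S' (t + 1) := fun v => by
  obtain ⟨v', h₁⟩ := h (v.1, false)
  refine ⟨v', .step (l' := some (some (.inr G.entry))) (v₁ := (v.1, false)) (S₁ := S)
    (by simp [ite, hp]) ?_⟩
  exact Run.embed (M' := (ite k p F G).code) (fun l => some (.inr l)) none (fun _ => rfl) h₁
    (.exit v' S' 0)

/-- Repetition while the head of a stack satisfies a condition. -/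
def loop (k : Option WorkStack) (p : Option (Alphabet k) → Bool) (F : Frag) : Frag where
  Label := Option F.Label
  entry := none
  code
    | none => .peek k (fun v s => (v.1, p s)) (.branch (fun v => v.2)
        (.goto fun _ => some (some F.entry)) (.goto fun _ => none))
    | some l => relabel (fun o => o.elim (some none) fun l => some (some l)) (F.code l)

theorem exec_loop_exit {k : Option WorkStack} {p : Option (Alphabet k) → Bool} (F : Frag)
    {S : Store} (hp : p (S k).head? = false) : (loop k p F).Exec S S 1 := fun v =>
  ⟨(v.1, false), .step (l' := none) (by simp [loop, hp]) (.exit _ _ 0)⟩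

theorem exec_loop_step {k : Option WorkStack} {p : Option (Alphabet k) → Bool} {F : Frag}
    {S S₁ S' : Store} {t t' : ℕ} (hp : p (S k).head? = true) (h : F.Exec S S₁ t)
    (h' : (loop k p F).Exec S₁ S' t') : (loop k p F).Exec S S' (t + t' + 1) := fun v => by
  obtain ⟨v₁, h₁⟩ := h (v.1, true)
  obtain ⟨v', h₂⟩ := h' v₁
  refine ⟨v', .step (l' := some (some F.entry)) (v₁ := (v.1, true)) (S₁ := S)
    (by simp [loop, hp]) ?_⟩
  exact Run.embed (M' := (loop k p F).code) some (some none) (fun _ => rfl) h₁ h₂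

/-! ### Operations on the trees on the main stack -/

/-- Do nothing. -/
def skip : Frag := block (.goto fun _ => none)

theorem exec_skip (S : Store) : skip.Exec S S 1 := exec_block fun v => ⟨v, rfl⟩

/-- Push a bit on the main stack. -/
def push (b : Bool) : Frag := block (.push (some .main) (fun _ => b) (.goto fun _ => none))

theorem exec_push (b : Bool) (io m l r c) :
    (push b).Exec (store io m l r c) (store io (b :: m) l r c) 1 :=
  exec_block fun v => ⟨v, by simp⟩

/-- Remove a bit from a work stack. -/
def pop (w : WorkStack) : Frag := block (.pop (some w) (fun v _ => v) (.goto fun _ => none))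

theorem exec_pop (b : Bool) (io m l r c) :
    (pop .main).Exec (store io (b :: m) l r c) (store io m l r c) 1 :=
  exec_block fun v => ⟨v, by simp⟩

/-- Move the contents of a work stack to another one. -/
def moveAll (w w' : WorkStack) : Frag :=
  loop (some w) Option.isSome <| block <| .pop (some w) (fun v b => (v.1, b.getD false)) <|
    .push (some w') (fun v => v.2) <| .goto fun _ => none

/-- Each bit costs a test and a move, and one last test finds the stack empty. Every move reverses
the word, so a word survives an even number of moves. -/
theorem exec_moveAll {w w' : WorkStack} (hw : w ≠ w') (S : Store) :
    (moveAll w w').Exec S (Function.update (Function.update S (some w) []) (some w')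
      ((S (some w)).reverse ++ S (some w'))) (2 * (S (some w)).length + 1) := by
  generalize hx : S (some w) = x
  induction x generalizing S with
  | nil =>
    have : Function.update (Function.update S (some w) []) (some w')
        (([] : List Bool).reverse ++ S (some w')) = S := by
      rw [List.reverse_nil, List.nil_append, (Function.update_eq_self_iff (f := S) (a := some w)).2 hx.symm,
        Function.update_eq_self]
    rw [this]
    exact exec_loop_exit _ (by rw [hx]; rfl)
  | cons b x ih =>
    refine (exec_loop_step (S := S) (t := 1) (t' := 2 * x.length + 1) (S₁ := Function.update (Function.update S (some w) x) (some w')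
      (b :: S (some w'))) (by rw [hx]; rfl) (exec_block fun v => ⟨(v.1, b), ?_⟩)
      (S' := Function.update (Function.update S (some w) []) (some w')
        ((b :: x).reverse ++ S (some w'))) ?_).mono ?_
    · simp [hx, hw.symm]
    · convert ih (Function.update (Function.update S (some w) x) (some w') (b :: S (some w')))
        (by simp [hw]) using 1
      · rfl
      funext k
      by_cases hk : k = some w'
      · subst hk; simp
      · by_cases hk' : k = some w
        · subst hk'; simp [hw]
        · simp [hk, hk']
    · simp; omega

/-- Move trees from the main stack to the left stack, as many as the counter says. -/
def extractCount : Frag :=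
  loop (some .count) Option.isSome <| block <|
    .pop (some .main) (fun v b => (v.1, b.getD false)) <| .push (some .left) (fun v => v.2) <|
    .branch (fun v => v.2) (.push (some .count) (fun _ => true) <| .goto fun _ => none)
      (.pop (some .count) (fun v _ => v) <| .goto fun _ => none)

/-- Polish notation is self-delimiting: the counter holds the number of trees still to be read, a
node bit replaces one pending tree by two, and a leaf bit completes one. The run that follows the
tree is a hypothesis, so that in the induction the runs for the two subtrees can be chained inside
one loop. -/
theorem exec_extractCount (t : BinTree) {io m l r c S' n}
    (h : extractCount.Exec (store io m (t.word.reverse ++ l) r c) S' n) :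
    extractCount.Exec (store io (t.word ++ m) l r (true :: c)) S' (2 * t.size + n) := by
  induction t generalizing m l c n with
  | leaf =>
    refine (exec_loop_step (t := 1) rfl (exec_block fun v => ⟨(v.1, false), ?_⟩) h).mono ?_
    · simp [BinTree.word]
    · rw [BinTree.size_leaf]; omega
  | node t₁ t₂ ih₁ ih₂ =>
    refine (exec_loop_step (t := 1) (S₁ := store io (t₁.word ++ (t₂.word ++ m)) (true :: l) r
      (true :: true :: c)) rfl (exec_block fun v => ⟨(v.1, true), ?_⟩)
      (ih₁ (ih₂ (n := n) ?_))).mono ?_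
    · simp [BinTree.word]
    · simpa [BinTree.word] using h
    · simp; omega

/-- Move a tree from the main stack to the left stack, which then holds the reversed word. -/
def extract : Frag :=
  seq (block <| .push (some .count) (fun _ => true) <| .goto fun _ => none) extractCount

theorem exec_extract (t : BinTree) (io m l r) :
    extract.Exec (store io (t.word ++ m) l r []) (store io m (t.word.reverse ++ l) r [])
      (2 * t.size + 2) := by
  refine (exec_seq (t := 1) (S₁ := store io (t.word ++ m) l r [true])
    (exec_block fun v => ⟨v, by simp⟩) (exec_extractCount t (exec_loop_exit _ rfl))).mono (by omega)

/-- Remove the top tree. -/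
def drop : Frag := seq extract (loop (some .left) Option.isSome (pop .left))

theorem exec_drop (t : BinTree) (io m) :
    drop.Exec (store io (t.word ++ m) [] [] []) (store io m [] [] []) (4 * t.size + 3) := by
  have key : ∀ l : List Bool, (loop (some .left) Option.isSome (pop .left)).Exec
      (store io m l [] []) (store io m [] [] []) (2 * l.length + 1) := by
    intro l
    induction l with
    | nil => exact exec_loop_exit _ rfl
    | cons b l ih =>
      refine (exec_loop_step (t := 1) rfl (exec_block fun v => ⟨v, ?_⟩) ih).mono ?_
      · simp
      · simp; omega
  refine (exec_seq (exec_extract t io m [] []) (key _)).mono ?_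
  simp [BinTree.size]; omega

/-- Duplicate the top tree. -/
def dup : Frag :=
  seq extract <| seq (loop (some .left) Option.isSome <| block <|
    .pop (some .left) (fun v b => (v.1, b.getD false)) <| .push (some .main) (fun v => v.2) <|
    .push (some .right) (fun v => v.2) <| .goto fun _ => none) <|
  seq (moveAll .right .left) (moveAll .left .main)

/-- Emptying the left stack writes the word to the main and the right stack at once; the second copy
returns by way of the left stack, which reverses it twice. -/
theorem exec_dup (t : BinTree) (io m) :
    dup.Exec (store io (t.word ++ m) [] [] []) (store io (t.word ++ (t.word ++ m)) [] [] [])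
      (8 * t.size + 5) := by
  have key : ∀ l m r : List Bool, (loop (some .left) Option.isSome <| block <|
      .pop (some .left) (fun v b => (v.1, b.getD false)) <| .push (some .main) (fun v => v.2) <|
      .push (some .right) (fun v => v.2) <| .goto fun _ => none).Exec
      (store io m l r []) (store io (l.reverse ++ m) [] (l.reverse ++ r) [])
      (2 * l.length + 1) := by
    intro l
    induction l with
    | nil => exact fun m r => exec_loop_exit _ rfl
    | cons b l ih =>
      intro m r
      refine (exec_loop_step (t := 1) rfl (exec_block fun v => ⟨(v.1, b), ?_⟩)
        (by simpa using ih (b :: m) (b :: r))).mono ?_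
      · simp
      · simp; omega
  have h₁ := exec_moveAll (w := .right) (w' := .left) (by simp)
    (store io (t.word ++ m) [] t.word [])
  have h₂ := exec_moveAll (w := .left) (w' := .main) (by simp)
    (store io (t.word ++ m) t.word.reverse [] [])
  simp only [store_main, store_left, store_right, update_main, update_left, update_right,
    List.reverse_reverse, List.append_nil] at h₁ h₂
  refine (exec_seq (exec_extract t io m [] []) (exec_seq (by simpa using key t.word.reverse m [])
    (exec_seq h₁ h₂))).mono ?_
  simp [BinTree.size]; omega

/-- Exchange the two top trees. -/
def swap : Frag :=
  seq extract <| seq (moveAll .left .right) <| seq extract <| seq (moveAll .right .count) <|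
  seq (moveAll .count .main) (moveAll .left .main)

/-- The word of `t` waits on the right stack while `u` is extracted, because extraction needs the
counter; only then does the count stack serve as the intermediate stop that restores the order of
the bits of `t`. -/
theorem exec_swap (t u : BinTree) (io m) :
    swap.Exec (store io (t.word ++ (u.word ++ m)) [] [] [])
      (store io (u.word ++ (t.word ++ m)) [] [] []) (8 * (t.size + u.size) + 8) := by
  have h₁ := exec_moveAll (w := .left) (w' := .right) (by simp)
    (store io (u.word ++ m) t.word.reverse [] [])
  have h₂ := exec_moveAll (w := .right) (w' := .count) (by simp)
    (store io m u.word.reverse t.word [])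
  have h₃ := exec_moveAll (w := .count) (w' := .main) (by simp)
    (store io m u.word.reverse [] t.word.reverse)
  have h₄ := exec_moveAll (w := .left) (w' := .main) (by simp)
    (store io (t.word ++ m) u.word.reverse [] [])
  simp only [store_main, store_left, store_right, store_count, update_main, update_left,
    update_right, update_count, List.reverse_reverse, List.append_nil] at h₁ h₂ h₃ h₄
  have h₀ := exec_extract t io (u.word ++ m) [] []
  have h₅ := exec_extract u io m [] t.word
  rw [List.append_nil] at h₀ h₅
  refine (exec_seq h₀ (exec_seq h₁ (exec_seq h₅ (exec_seq h₂ (exec_seq h₃ h₄))))).mono ?_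
  simp [BinTree.size]; omega

/-- Push the word of a tree. -/
def pushTree : BinTree → Frag
  | .leaf => push false
  | .node t u => seq (pushTree u) (seq (pushTree t) (push true))

theorem exec_pushTree (t : BinTree) (io m) :
    (pushTree t).Exec (store io m [] [] []) (store io (t.word ++ m) [] [] []) t.size := by
  induction t generalizing m with
  | leaf => exact exec_push _ _ _ _ _ _
  | node t u iht ihu =>
    refine (exec_seq (ihu m) (exec_seq (iht _) ?_)).mono (t := u.size + (t.size + 1)) ?_
    · simpa [BinTree.word] using exec_push true io (t.word ++ (u.word ++ m)) [] [] []
    · simp; omega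

end Frag

end ColorAvoiding

namespace ColorAvoiding

open Turing

/-! ### Polynomial-time functions on data that are represented by trees -/

/-- Representation of data by trees. -/
class TreeCode (α : Type) where
  tree : α → BinTree

open TreeCode

/-- The size of the representation. -/
def treeSize {α : Type} [TreeCode α] (a : α) : ℕ := (tree a).size

instance : TreeCode Unit := ⟨fun _ => .leaf⟩

/-- Unary notation: a number has the tree of a list of that many units, so arithmetic reduces to
operations on lists. The price is that all numbers in the algorithm must have polynomially bounded
values. -/
instance : TreeCode ℕ := ⟨Nat.rec .leaf fun _ t => .node .leaf t⟩

instance : TreeCode Bool := ⟨fun b => bif b then .node .leaf .leaf else .leaf⟩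

instance {α β : Type} [TreeCode α] [TreeCode β] : TreeCode (α × β) :=
  ⟨fun p => .node (tree p.1) (tree p.2)⟩

/-- A nonempty list has the same tree as the pair of its head and tail, so passing between the two
costs nothing, and the first bit of the word tells whether the list is empty. -/
instance {α : Type} [TreeCode α] : TreeCode (List α) :=
  ⟨List.foldr (fun a t => .node (tree a) t) .leaf⟩

/-- The number that represents a symbol. -/
def Symbol.index : Symbol → ℕ
  | zero => 0
  | one => 1
  | comma => 2
  | semicolon => 3

instance : TreeCode Symbol := ⟨fun s => tree s.index⟩

section
variable {α β : Type} [TreeCode α] [TreeCode β]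

@[simp] theorem tree_nil : tree ([] : List α) = .leaf := rfl
@[simp] theorem tree_cons (a : α) (l : List α) : tree (a :: l) = .node (tree a) (tree l) := rfl
@[simp] theorem tree_pair (a : α) (b : β) : tree (a, b) = .node (tree a) (tree b) := rfl
@[simp] theorem tree_nat_succ (n : ℕ) : tree (n + 1) = .node .leaf (tree n) := rfl

@[simp] theorem treeSize_nil : treeSize ([] : List α) = 1 := rfl
@[simp] theorem treeSize_cons (a : α) (l : List α) :
    treeSize (a :: l) = treeSize a + treeSize l + 1 := by simp [treeSize]
@[simp] theorem treeSize_pair (a : α) (b : β) :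
    treeSize (a, b) = treeSize a + treeSize b + 1 := by simp [treeSize]

theorem one_le_size (t : BinTree) : 1 ≤ t.size := by
  cases t <;> simp

theorem one_le_treeSize (a : α) : 1 ≤ treeSize a := one_le_size _

theorem length_lt_treeSize (l : List α) : l.length < treeSize l := by
  induction l with
  | nil => simp
  | cons a l ih => simp; omega

end

/-- Coefficients in `ℕ` are nonnegative; this is what allows bounds to be substituted into each
other. -/
theorem eval_mono (p : Polynomial ℕ) {m n : ℕ} (h : m ≤ n) : p.eval m ≤ p.eval n := by
  rw [Polynomial.eval_eq_sum_range, Polynomial.eval_eq_sum_range]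
  gcongr

/-- `f` is computed by a program fragment in time polynomial in the size of the argument. -/
def PolyFun {α β : Type} [TreeCode α] [TreeCode β] (f : α → β) : Prop :=
  ∃ (F : Frag) (p : Polynomial ℕ), ∀ a, treeSize (f a) ≤ p.eval (treeSize a) ∧
    ∀ io m, F.Exec (store io ((tree a).word ++ m) [] [] [])
      (store io ((tree (f a)).word ++ m) [] [] []) (p.eval (treeSize a))

/-- A quantity that is bounded by a polynomial in the size of the argument. -/
def PolyBounded {α : Type} [TreeCode α] (h : α → ℕ) : Prop :=
  ∃ p : Polynomial ℕ, ∀ a, h a ≤ p.eval (treeSize a)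

/-! ### Polynomial bounds and the basic closure properties of `PolyFun` -/

section
variable {α β γ σ : Type} [TreeCode α] [TreeCode β] [TreeCode γ] [TreeCode σ]

namespace PolyBounded

theorem mono {h h' : α → ℕ} (H : PolyBounded h) (hh : ∀ a, h' a ≤ h a) : PolyBounded h' :=
  let ⟨p, hp⟩ := H
  ⟨p, fun a => (hh a).trans (hp a)⟩

theorem const (c : ℕ) : PolyBounded fun _ : α => c :=
  ⟨.C c, fun _ => by simp⟩

theorem treeSize : PolyBounded fun a : α => treeSize a :=
  ⟨.X, fun a => by simp⟩

theorem add {h h' : α → ℕ} (H : PolyBounded h) (H' : PolyBounded h') :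
    PolyBounded fun a => h a + h' a :=
  let ⟨p, hp⟩ := H
  let ⟨q, hq⟩ := H'
  ⟨p + q, fun a => by simpa using Nat.add_le_add (hp a) (hq a)⟩

theorem mul {h h' : α → ℕ} (H : PolyBounded h) (H' : PolyBounded h') :
    PolyBounded fun a => h a * h' a :=
  let ⟨p, hp⟩ := H
  let ⟨q, hq⟩ := H'
  ⟨p * q, fun a => by simpa using Nat.mul_le_mul (hp a) (hq a)⟩

theorem eval (p : Polynomial ℕ) {h : α → ℕ} (H : PolyBounded h) :
    PolyBounded fun a => p.eval (h a) :=
  let ⟨q, hq⟩ := H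
  ⟨p.comp q, fun a => by simpa using eval_mono p (hq a)⟩

end PolyBounded

namespace PolyFun

theorem bounded {f : α → β} (hf : PolyFun f) : PolyBounded fun a => treeSize (f a) :=
  let ⟨_, p, h⟩ := hf
  ⟨p, fun a => (h a).1⟩

theorem of_exec {f : α → β} (F : Frag) {t : α → ℕ} (hs : PolyBounded fun a => treeSize (f a))
    (ht : PolyBounded t) (h : ∀ a io m, F.Exec (store io ((tree a).word ++ m) [] [] [])
      (store io ((tree (f a)).word ++ m) [] [] []) (t a)) : PolyFun f := by
  obtain ⟨p, hp⟩ := hs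
  obtain ⟨q, hq⟩ := ht
  refine ⟨F, p + q, fun a => ⟨?_, fun io m => (h a io m).mono ?_⟩⟩
  · simpa using (hp a).trans (Nat.le_add_right _ _)
  · simpa using (hq a).trans (Nat.le_add_left _ _)

theorem exists_exec {f : α → β} (hf : PolyFun f) : ∃ (F : Frag) (p : Polynomial ℕ),
    ∀ a io m, F.Exec (store io ((tree a).word ++ m) [] [] [])
      (store io ((tree (f a)).word ++ m) [] [] []) (p.eval (treeSize a)) :=
  let ⟨F, p, h⟩ := hf
  ⟨F, p, fun a => (h a).2⟩

/-- Functions that do not change the representation. -/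
theorem of_tree_eq {f : α → β} (h : ∀ a, tree (f a) = tree a) : PolyFun f :=
  of_exec .skip (.mono .treeSize fun a => by simp [treeSize, h]) (.const 1) fun a io m => by
    rw [h]; exact Frag.exec_skip _

theorem id : PolyFun fun a : α => a := of_tree_eq fun _ => rfl

/-- The time of the second program depends on the size of the intermediate result, which is why
`PolyFun` records a bound on the output size beside the running time. -/
theorem comp {f : β → γ} {g : α → β} (hf : PolyFun f) (hg : PolyFun g) :
    PolyFun fun a => f (g a) := by
  obtain ⟨F, p, hF⟩ := hf
  obtain ⟨G, q, hG⟩ := hg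
  refine of_exec (.seq G F) (.mono (.eval p (.eval q .treeSize)) fun a => ?_)
    (.add (.eval q .treeSize) (.eval p (.eval q .treeSize))) fun a io m =>
    (Frag.exec_seq ((hG a).2 io m) ((hF (g a)).2 io m)).mono ?_
  · exact (hF _).1.trans (eval_mono p (hG a).1)
  · have := eval_mono p (hG a).1
    omega

theorem const (b : β) : PolyFun fun _ : α => b :=
  of_exec (.seq .drop (.pushTree (tree b))) (.const (treeSize b))
    (.add (.add (.mul (.const 4) .treeSize) (.const 3)) (.const (treeSize b))) fun _ io m =>
    Frag.exec_seq (Frag.exec_drop _ io m) (Frag.exec_pushTree _ io m)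

/-- The value of `g` is computed first on one copy of the argument, so that the word of `f a` ends
up on top; a node bit in front of the two words makes them a pair. -/
theorem pair {f : α → β} {g : α → γ} (hf : PolyFun f) (hg : PolyFun g) :
    PolyFun fun a => (f a, g a) := by
  have bf := hf.bounded
  have bg := hg.bounded
  obtain ⟨F, p, hF⟩ := hf.exists_exec
  obtain ⟨G, q, hG⟩ := hg.exists_exec
  refine of_exec (.seq .dup <| .seq G <| .seq .swap <| .seq F (.push true))
    (.mono (.add (.add bf bg) (.const 1)) fun a => (treeSize_pair _ _).le)
    (.add (.add (.mul (.const 8) .treeSize) (.const 5)) <| .add (.eval q .treeSize) <|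
      .add (.add (.mul (.const 8) (.add bg .treeSize)) (.const 8)) <|
      .add (.eval p .treeSize) (.const 1)) fun a io m => ?_
  refine Frag.exec_seq (Frag.exec_dup _ io m) <| Frag.exec_seq (hG a io _) <|
    Frag.exec_seq (Frag.exec_swap _ _ io m) <| Frag.exec_seq (hF a io _) ?_
  simpa [BinTree.word] using
    Frag.exec_push true io ((tree (f a)).word ++ ((tree (g a)).word ++ m)) [] [] []

theorem fst : PolyFun fun p : α × β => p.1 := by
  refine of_exec (.seq (.pop .main) <| .seq .swap .drop)
    (.mono .treeSize fun ⟨a, b⟩ => by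
      rw [treeSize_pair]; show treeSize a ≤ _; omega)
    (.add (.const 1) <| .add (.add (.mul (.const 8) .treeSize) (.const 8))
      (.add (.mul (.const 4) .treeSize) (.const 3))) fun ⟨a, b⟩ io m => ?_
  refine (Frag.exec_seq (t := 1) (S₁ := store io ((tree a).word ++ ((tree b).word ++ m)) [] [] [])
    ?_ <| Frag.exec_seq (Frag.exec_swap _ _ io m) (Frag.exec_drop _ io _)).mono ?_
  · simpa [BinTree.word] using
      Frag.exec_pop true io ((tree a).word ++ ((tree b).word ++ m)) [] [] []
  · simp only [treeSize, tree_pair, BinTree.size_node]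
    omega

theorem snd : PolyFun fun p : α × β => p.2 := by
  refine of_exec (.seq (.pop .main) .drop)
    (.mono .treeSize fun ⟨a, b⟩ => by
      rw [treeSize_pair]; show treeSize b ≤ _; omega)
    (.add (.const 1) (.add (.mul (.const 4) .treeSize) (.const 3))) fun ⟨a, b⟩ io m => ?_
  refine (Frag.exec_seq (t := 1) (S₁ := store io ((tree a).word ++ ((tree b).word ++ m)) [] [] [])
    ?_ (Frag.exec_drop _ io _)).mono ?_
  · simpa [BinTree.word] using
      Frag.exec_pop true io ((tree a).word ++ ((tree b).word ++ m)) [] [] []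
  · simp only [treeSize, tree_pair, BinTree.size_node]
    omega

/-- Case distinction by a list. -/
theorem list_cases {f : α → γ} {L : α → List β} {g : α → γ} {h : α × β × List β → γ}
    (hL : PolyFun L) (hg : PolyFun g) (hh : PolyFun h) (h_nil : ∀ a, L a = [] → f a = g a)
    (h_cons : ∀ a b l, L a = b :: l → f a = h (a, b, l)) : PolyFun f := by
  have bL := hL.bounded
  obtain ⟨FL, pL, hFL⟩ := hL.exists_exec
  obtain ⟨G, q, hG⟩ := hg
  obtain ⟨H, r, hH⟩ := hh
  have bh : PolyBounded fun a => r.eval (treeSize a + treeSize (L a) + 1) :=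
    .eval r (.add (.add .treeSize bL) (.const 1))
  refine of_exec (.seq .dup <| .seq FL <| .ite (some .main) (fun b => b.getD false)
    (.seq .swap <| .seq (.push true) H) (.seq (.pop .main) G))
    (.mono (.add (.eval q .treeSize) bh) fun a => ?_)
    (.add (.add (.mul (.const 8) .treeSize) (.const 5)) <| .add (.eval pL .treeSize) <|
      .add (.add (.add (.add (.mul (.const 8) (.add bL .treeSize)) (.const 8))
        (.add (.const 1) bh)) (.add (.const 1) (.eval q .treeSize))) (.const 1))
    fun a io m => ?_
  · cases ha : L a with
    | nil => rw [h_nil a ha]; exact (hG a).1.trans (Nat.le_add_right _ _)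
    | cons b l =>
      rw [h_cons a b l ha]
      refine (hH _).1.trans ((eval_mono r ?_).trans (Nat.le_add_left _ _))
      rw [treeSize_pair]
      simp
  · refine Frag.exec_seq (Frag.exec_dup _ io m) <| Frag.exec_seq (hFL a io _) ?_
    cases ha : L a with
    | nil =>
      refine (Frag.exec_ite_false (t := 1 + q.eval (treeSize a)) rfl
        (Frag.exec_seq (Frag.exec_pop false io ((tree a).word ++ m) [] [] []) ?_)).mono ?_
      · rw [h_nil a ha]; exact (hG a).2 io m
      · omega
    | cons b l =>
      -- After the exchange the words of `a` and of `b :: l` lie on the stack; a node bit in front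
      -- turns them into the tree of `(a, b, l)`.
      refine (Frag.exec_ite_true rfl
        (Frag.exec_seq (Frag.exec_swap _ _ io m)
          (Frag.exec_seq (t' := r.eval (treeSize (a, b, l)))
            (Frag.exec_push true _ _ _ _ _) ?_))).mono ?_
      · rw [h_cons a b l ha]
        simpa [BinTree.word] using (hH (a, b, l)).2 io m
      · have e : treeSize (a, b, l) = treeSize a + treeSize (b :: l) + 1 := by simp
        rw [e]
        simp only [treeSize]
        omega

/-- The loop keeps the remaining list above the state. A node bit joins them to a pair, the body `B`
consumes one entry, and the node bit is removed again, so the first bit of the list is exposed for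
the test. The leaf of the empty list is discarded at the end. -/
theorem list_foldl_aux {g : β × σ → σ} (hg : PolyFun g) {L : α → List β} {I : α → σ}
    (hL : PolyFun L) (hI : PolyFun I) {q : α → ℕ} (hq : PolyBounded q)
    (h : ∀ a l, l <+: L a → treeSize (l.foldl (fun s b => g (b, s)) (I a)) ≤ q a) :
    PolyFun fun a => (L a).foldl (fun s b => g (b, s)) (I a) := by
  have hB : PolyFun fun p : List β × σ =>
      List.casesOn (motive := fun _ => List β × σ) p.1 p fun b l => (l, g (b, p.2)) :=
    list_cases (g := fun p => p)
      (h := fun x : (List β × σ) × β × List β => (x.2.2, g (x.2.1, x.1.2)))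
      fst id (pair (snd.comp snd) (hg.comp (pair (fst.comp snd) (snd.comp fst))))
      (fun a ha => by rw [ha]) (fun a b l ha => by rw [ha])
  have bL := hL.bounded
  obtain ⟨B, p, hB⟩ := hB.exists_exec
  obtain ⟨F, r, hF⟩ := (hL.pair hI).exists_exec
  -- `N` bounds the remaining list and `M` all states still to come, so every round has the same
  -- bound: the body, plus a test, a push and a pop.
  have key : ∀ (N M : ℕ) (io m) (l : List β) (s : σ), treeSize l ≤ N →
      (∀ l', l' <+: l → treeSize (l'.foldl (fun s b => g (b, s)) s) ≤ M) →
      (Frag.loop (some .main) (fun b => b.getD false)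
        (.seq (.push true) <| .seq B (.pop .main))).Exec
        (store io ((tree l).word ++ ((tree s).word ++ m)) [] [] [])
        (store io (false :: ((tree (l.foldl (fun s b => g (b, s)) s)).word ++ m)) [] [] [])
        (l.length * (p.eval (N + M + 1) + 3) + 1) := by
    intro N M io m l
    induction l with
    | nil => exact fun s _ _ => (Frag.exec_loop_exit _ rfl).mono (by simp)
    | cons b l ih =>
      intro s hN hM
      have hs : treeSize s ≤ M := hM [] List.nil_prefix
      have hNl : treeSize l ≤ N := by rw [treeSize_cons] at hN; omega
      have h₁ := hB (b :: l, s) io m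
      refine (Frag.exec_loop_step
        (S₁ := store io ((tree l).word ++ ((tree (g (b, s))).word ++ m)) [] [] [])
        (t := 1 + (p.eval (treeSize (b :: l, s)) + 1)) rfl
        (Frag.exec_seq (Frag.exec_push true _ _ _ _ _) <| Frag.exec_seq
          (by simpa [BinTree.word] using h₁) ?_)
        (ih (g (b, s)) hNl fun l' hl' => hM (b :: l') ?_)).mono ?_
      · simpa [BinTree.word] using
          Frag.exec_pop true io ((tree l).word ++ ((tree (g (b, s))).word ++ m)) [] [] []
      · simpa using hl'
      · have : p.eval (treeSize (b :: l, s)) ≤ p.eval (N + M + 1) :=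
          eval_mono p (by rw [treeSize_pair]; omega)
        rw [List.length_cons, Nat.succ_mul]
        omega
  refine of_exec (.seq F <| .seq (.pop .main) <| .seq (.loop (some .main) (fun b => b.getD false)
        (.seq (.push true) <| .seq B (.pop .main))) (.pop .main))
    (.mono hq fun a => h a _ (List.prefix_refl _))
    (.add (.eval r .treeSize) <| .add (.const 1) <|
      .add (.add (.mul bL (.add (.eval p (.add (.add bL hq) (.const 1))) (.const 3))) (.const 1))
        (.const 1)) fun a io m => ?_
  refine Frag.exec_seq (hF a io m) <| Frag.exec_seq
    (S₁ := store io ((tree (L a)).word ++ ((tree (I a)).word ++ m)) [] [] []) ?_ <|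
    Frag.exec_seq ((key _ _ io m (L a) (I a) le_rfl (h a)).mono ?_)
      (Frag.exec_pop false _ _ _ _ _)
  · simpa [BinTree.word] using
      Frag.exec_pop true io ((tree (L a)).word ++ ((tree (I a)).word ++ m)) [] [] []
  · gcongr
    exact (length_lt_treeSize _).le

end PolyFun

end

end ColorAvoiding

namespace ColorAvoiding

open TreeCode

/-! #### Folds and lists -/

section
variable {α β γ σ : Type} [TreeCode α] [TreeCode β] [TreeCode γ] [TreeCode σ]

namespace PolyFun

attribute [fun_prop] PolyFun PolyFun.id PolyFun.const PolyFun.comp PolyFun.pair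

@[fun_prop]
theorem prod_fst {f : α → β × γ} (hf : PolyFun f) : PolyFun fun a => (f a).1 := fst.comp hf

@[fun_prop]
theorem prod_snd {f : α → β × γ} (hf : PolyFun f) : PolyFun fun a => (f a).2 := snd.comp hf

/-- The step may depend on the argument `a`, which is therefore carried along unchanged as part of
the state. -/
theorem list_foldl {L : α → List β} {I : α → σ} {g : α → σ → β → σ} (hL : PolyFun L)
    (hI : PolyFun I) (hg : PolyFun fun x : α × σ × β => g x.1 x.2.1 x.2.2) {q : α → ℕ}
    (hq : PolyBounded q) (h : ∀ a l, l <+: L a → treeSize (l.foldl (g a) (I a)) ≤ q a) :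
    PolyFun fun a => (L a).foldl (g a) (I a) := by
  have e : ∀ a (l : List β) (s : σ),
      l.foldl (fun (x : α × σ) b => (x.1, g x.1 x.2 b)) (a, s) = (a, l.foldl (g a) s) := by
    intro a l
    induction l with
    | nil => exact fun s => rfl
    | cons b l ih => exact fun s => ih _
  have := list_foldl_aux (g := fun x : β × α × σ => (x.2.1, g x.2.1 x.2.2 x.1)) (L := L)
    (I := fun a => (a, I a)) ?_ hL (by fun_prop)
    (q := fun a => treeSize a + q a + 1) (.add (.add .treeSize hq) (.const 1)) ?_
  · simpa only [e] using prod_snd this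
  · exact pair (by fun_prop) (hg.comp (g := fun x : β × α × σ => (x.2.1, x.2.2, x.1)) (by fun_prop))
  · intro a l hl
    rw [e, treeSize_pair]
    have := h a l hl
    omega

/-- A fold in which every step increases the size by a bounded amount. -/
theorem list_foldl_of_growth {L : α → List β} {I : α → σ} {g : α → σ → β → σ} (hL : PolyFun L)
    (hI : PolyFun I) (hg : PolyFun fun x : α × σ × β => g x.1 x.2.1 x.2.2) {q : α × β → ℕ}
    (hq : PolyBounded q)
    (h : ∀ a s b, treeSize (g a s b) ≤ treeSize s + q (a, b)) :
    PolyFun fun a => (L a).foldl (g a) (I a) := by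
  obtain ⟨p, hp⟩ := hq
  -- The increments add up: each is at most a polynomial in the sizes of `a` and of the whole list,
  -- and their number is the length.
  have key : ∀ a (N : ℕ) (l : List β) (s : σ), treeSize l ≤ N →
      treeSize (l.foldl (g a) s) ≤ treeSize s + l.length * p.eval (treeSize a + N + 1) := by
    intro a N l
    induction l with
    | nil => simp
    | cons b l ih =>
      intro s hl
      rw [treeSize_cons] at hl
      have h₁ := ih (g a s b) (by omega)
      have h₂ := (h a s b).trans (Nat.add_le_add_left (hp (a, b)) _)
      have h₃ : p.eval (treeSize (a, b)) ≤ p.eval (treeSize a + N + 1) :=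
        eval_mono p (by rw [treeSize_pair]; omega)
      rw [List.foldl_cons, List.length_cons, Nat.succ_mul]
      omega
  refine list_foldl hL hI hg (.add hI.bounded (.mul hL.bounded
    (.eval p (.add (.add .treeSize hL.bounded) (.const 1))))) fun a l hl => ?_
  have hs : treeSize l ≤ treeSize (L a) := by
    obtain ⟨r, hr⟩ := hl
    rw [← hr]
    clear hr
    induction l with
    | nil => exact one_le_treeSize _
    | cons b l ih => simpa using ih
  refine (key a _ l (I a) hs).trans ?_
  gcongr
  exact (length_lt_treeSize l).le.trans hs

@[fun_prop]
theorem list_cons {f : α → β} {g : α → List β} (hf : PolyFun f) (hg : PolyFun g) :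
    PolyFun fun a => f a :: g a :=
  comp (f := fun p : β × List β => p.1 :: p.2) (of_tree_eq fun _ => rfl) (hf.pair hg)

@[fun_prop]
theorem list_reverse {L : α → List β} (hL : PolyFun L) : PolyFun fun a => (L a).reverse := by
  have := list_foldl_of_growth (g := fun (_ : α) (s : List β) b => b :: s) hL (const [])
    (by fun_prop) (q := fun x : α × β => treeSize x) .treeSize
    fun a s b => by simp; omega
  simpa only [← List.foldr_reverse, List.foldr_cons_nil] using this

theorem list_foldr_of_growth {L : α → List β} {I : α → σ} {g : α → β → σ → σ} (hL : PolyFun L)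
    (hI : PolyFun I) (hg : PolyFun fun x : α × β × σ => g x.1 x.2.1 x.2.2) {q : α × β → ℕ}
    (hq : PolyBounded q)
    (h : ∀ a s b, treeSize (g a b s) ≤ treeSize s + q (a, b)) :
    PolyFun fun a => (L a).foldr (g a) (I a) := by
  have := list_foldl_of_growth (g := fun a s b => g a b s) (list_reverse hL) hI
    (hg.comp (g := fun x : α × σ × β => (x.1, x.2.2, x.2.1)) (by fun_prop)) hq h
  simpa only [List.foldl_reverse] using this

@[fun_prop]
theorem list_map {L : α → List β} {g : α → β → γ} (hL : PolyFun L)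
    (hg : PolyFun fun x : α × β => g x.1 x.2) : PolyFun fun a => (L a).map (g a) := by
  have := list_foldr_of_growth (g := fun (a : α) (b : β) (s : List γ) => g a b :: s) hL (const [])
    (list_cons (hg.comp (g := fun x : α × β × List γ => (x.1, x.2.1)) (by fun_prop)) (by fun_prop))
    (q := fun x => treeSize (g x.1 x.2) + 1) (.add hg.bounded (.const 1))
    fun a s b => by simp; omega
  simpa only [List.map_eq_foldr] using this

@[fun_prop]
theorem list_append {L M : α → List β} (hL : PolyFun L) (hM : PolyFun M) :
    PolyFun fun a => L a ++ M a := by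
  have := list_foldr_of_growth (g := fun (_ : α) (b : β) (s : List β) => b :: s) hL hM
    (by fun_prop) (q := fun x : α × β => treeSize x) .treeSize fun a s b => by simp; omega
  simpa using this

theorem treeSize_append (l m : List β) : treeSize (l ++ m) ≤ treeSize l + treeSize m := by
  induction l with
  | nil => simp
  | cons b l ih => simp; omega

@[fun_prop]
theorem list_flatten {L : α → List (List β)} (hL : PolyFun L) :
    PolyFun fun a => (L a).flatten := by
  have := list_foldr_of_growth (g := fun (_ : α) (b : List β) (s : List β) => b ++ s) hL (const [])
    (by fun_prop) (q := fun x : α × List β => treeSize x) .treeSize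
    fun a s b => by have := treeSize_append b s; simp; omega
  convert this with a
  induction L a with
  | nil => rfl
  | cons b l ih => simp [ih]

@[fun_prop]
theorem list_flatMap {L : α → List β} {g : α → β → List γ} (hL : PolyFun L)
    (hg : PolyFun fun x : α × β => g x.1 x.2) : PolyFun fun a => (L a).flatMap (g a) := by
  simpa only [List.flatMap_def] using list_flatten (list_map hL hg)

/-! #### Booleans -/

/-- A Boolean value has the tree of a list with at most one unit, so this is a case distinction by a
list. -/
theorem cond {c : α → Bool} {f g : α → β} (hc : PolyFun c) (hf : PolyFun f) (hg : PolyFun g) :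
    PolyFun fun a => bif c a then f a else g a := by
  have h : PolyFun fun a => bif c a then [()] else [] :=
    comp (f := fun b : Bool => bif b then [()] else []) (of_tree_eq fun b => by cases b <;> rfl) hc
  refine list_cases (h := fun x => f x.1) h hg (hf.comp fst) (fun a ha => ?_) fun a b l ha => ?_
  · cases hca : c a <;> simp_all
  · cases hca : c a <;> simp_all

attribute [fun_prop] cond

@[fun_prop]
theorem and {b c : α → Bool} (hb : PolyFun b) (hc : PolyFun c) : PolyFun fun a => b a && c a := by
  have : PolyFun fun a => bif b a then c a else false := by fun_prop
  convert this with a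
  cases b a <;> rfl

@[fun_prop]
theorem or {b c : α → Bool} (hb : PolyFun b) (hc : PolyFun c) : PolyFun fun a => b a || c a := by
  have : PolyFun fun a => bif b a then true else c a := by fun_prop
  convert this with a
  cases b a <;> rfl

@[fun_prop]
theorem not {b : α → Bool} (hb : PolyFun b) : PolyFun fun a => !b a := by
  have : PolyFun fun a => bif b a then false else true := by fun_prop
  convert this with a
  cases b a <;> rfl

theorem treeSize_bool (b : Bool) : treeSize b ≤ 3 := by
  cases b <;> simp [treeSize, tree]

@[fun_prop]
theorem list_all {L : α → List β} {g : α → β → Bool} (hL : PolyFun L)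
    (hg : PolyFun fun x : α × β => g x.1 x.2) : PolyFun fun a => (L a).all (g a) := by
  have := list_foldr_of_growth (g := fun (a : α) (b : β) s => g a b && s) hL (const true)
    (and (hg.comp (g := fun x : α × β × Bool => (x.1, x.2.1)) (by fun_prop)) (by fun_prop))
    (.const 3) fun a s b => (treeSize_bool _).trans (Nat.le_add_left _ _)
  convert this with a
  induction L a with
  | nil => rfl
  | cons b l ih => simp [ih]

@[fun_prop]
theorem list_any {L : α → List β} {g : α → β → Bool} (hL : PolyFun L)
    (hg : PolyFun fun x : α × β => g x.1 x.2) : PolyFun fun a => (L a).any (g a) := by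
  have := list_foldr_of_growth (g := fun (a : α) (b : β) s => g a b || s) hL (const false)
    (or (hg.comp (g := fun x : α × β × Bool => (x.1, x.2.1)) (by fun_prop)) (by fun_prop))
    (.const 3) fun a s b => (treeSize_bool _).trans (Nat.le_add_left _ _)
  convert this with a
  induction L a with
  | nil => rfl
  | cons b l ih => simp [ih]

@[fun_prop]
theorem list_filter {L : α → List β} {g : α → β → Bool} (hL : PolyFun L)
    (hg : PolyFun fun x : α × β => g x.1 x.2) : PolyFun fun a => (L a).filter (g a) := by
  have := list_flatMap (g := fun a b => bif g a b then [b] else []) hL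
    (cond hg (by fun_prop) (by fun_prop))
  convert this with a
  induction L a with
  | nil => rfl
  | cons b l ih => cases h : g a b <;> simp [h, ih]

@[fun_prop]
theorem list_isEmpty {L : α → List β} (hL : PolyFun L) : PolyFun fun a => (L a).isEmpty :=
  list_cases (g := fun _ => true) (h := fun _ => false) hL (const _) (const _)
    (fun a ha => by rw [ha]; rfl) fun a b l ha => by rw [ha]; rfl

@[fun_prop]
theorem list_tail {L : α → List β} (hL : PolyFun L) : PolyFun fun a => (L a).tail :=
  list_cases (g := fun _ => []) (h := fun x => x.2.2) hL (const _) (by fun_prop)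
    (fun a ha => by rw [ha]; rfl) fun a b l ha => by rw [ha]; rfl

@[fun_prop]
theorem list_headD {L : α → List β} {f : α → β} (hL : PolyFun L) (hf : PolyFun f) :
    PolyFun fun a => (L a).headD (f a) :=
  list_cases (g := f) (h := fun x => x.2.1) hL hf (by fun_prop)
    (fun a ha => by rw [ha]; rfl) fun a b l ha => by rw [ha]; rfl

/-! #### Natural numbers -/

theorem tree_replicate_unit (n : ℕ) : tree (List.replicate n ()) = tree n := by
  induction n with
  | zero => rfl
  | succ n ih => rw [List.replicate_succ, tree_cons, ih]; rfl

@[fun_prop]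
theorem replicate_unit {f : α → ℕ} (hf : PolyFun f) : PolyFun fun a => List.replicate (f a) () :=
  comp (f := fun n => List.replicate n ()) (of_tree_eq tree_replicate_unit) hf

-- Once all entries are replaced by units, the tree of the list is already the tree of its length.
@[fun_prop]
theorem list_length {L : α → List β} (hL : PolyFun L) : PolyFun fun a => (L a).length := by
  have h : PolyFun fun l : List Unit => l.length := of_tree_eq fun l => by
    rw [← tree_replicate_unit, List.eq_replicate_of_mem (a := ()) (l := l) fun _ _ => rfl]
    simp
  simpa using h.comp (list_map (g := fun _ _ => ()) hL (const _))

@[fun_prop]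
theorem nat_succ {f : α → ℕ} (hf : PolyFun f) : PolyFun fun a => f a + 1 := by
  simpa using list_length (list_cons (const ()) (replicate_unit hf))

@[fun_prop]
theorem nat_add {f g : α → ℕ} (hf : PolyFun f) (hg : PolyFun g) : PolyFun fun a => f a + g a := by
  simpa using list_length (list_append (replicate_unit hf) (replicate_unit hg))

theorem treeSize_nat (n : ℕ) : treeSize n = 2 * n + 1 := by
  induction n with
  | zero => rfl
  | succ n ih => simp only [treeSize, tree_nat_succ, BinTree.size_node] at ih ⊢; simp; omega

@[fun_prop]
theorem nat_sub {f g : α → ℕ} (hf : PolyFun f) (hg : PolyFun g) : PolyFun fun a => f a - g a := by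
  have := list_length <| list_foldl_of_growth (g := fun (_ : α) (s : List Unit) (_ : Unit) => s.tail)
    (replicate_unit hg) (replicate_unit hf) (by fun_prop) (.const 0) fun a s b => by
      cases s <;> simp; omega
  have e : ∀ (n : ℕ) (l : List Unit),
      (List.replicate n ()).foldl (fun s _ => s.tail) l = l.drop n := by
    intro n
    induction n with
    | zero => simp
    | succ n ih => intro l; simp [List.replicate_succ, ih]
  simpa [e] using this

@[fun_prop]
theorem nat_ble {f g : α → ℕ} (hf : PolyFun f) (hg : PolyFun g) :
    PolyFun fun a => decide (f a ≤ g a) := by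
  have : PolyFun fun a => (List.replicate (f a - g a) ()).isEmpty := by fun_prop
  convert this with a
  rw [Bool.eq_iff_iff]
  simp
  omega

@[fun_prop]
theorem nat_blt {f g : α → ℕ} (hf : PolyFun f) (hg : PolyFun g) :
    PolyFun fun a => decide (f a < g a) :=
  nat_ble (nat_succ hf) hg

@[fun_prop]
theorem nat_beq {f g : α → ℕ} (hf : PolyFun f) (hg : PolyFun g) :
    PolyFun fun a => f a == g a := by
  have : PolyFun fun a => decide (f a ≤ g a) && decide (g a ≤ f a) := by fun_prop
  convert this with a
  rw [Bool.eq_iff_iff]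
  simp
  omega

theorem treeSize_le_of_forall_le {l : List β} {c : ℕ} (h : ∀ b ∈ l, treeSize b ≤ c) :
    treeSize l ≤ l.length * (c + 1) + 1 := by
  induction l with
  | nil => simp
  | cons b l ih =>
    have h₁ := h b (by simp)
    have h₂ := ih fun b hb => h b (by simp [hb])
    rw [treeSize_cons, List.length_cons, Nat.succ_mul]
    omega

-- The length of the list built so far is the next entry. The increment thus depends on the state,
-- so all states are bounded directly: at most `f a` entries, each smaller than `f a`.
@[fun_prop]
theorem list_range {f : α → ℕ} (hf : PolyFun f) : PolyFun fun a => List.range (f a) := by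
  have e : ∀ (l : List Unit), l.foldl (fun (s : List ℕ) _ => s.length :: s) [] =
      (List.range l.length).reverse := by
    intro l
    induction l using List.reverseRecOn with
    | nil => rfl
    | append_singleton l b ih => simp [ih, List.range_succ]
  have := list_reverse <| list_foldl (g := fun (_ : α) (s : List ℕ) (_ : Unit) => s.length :: s)
    (replicate_unit hf) (const []) (by fun_prop)
    (q := fun a => treeSize (f a) * (treeSize (f a) + 1) + 1)
    (.add (.mul hf.bounded (.add hf.bounded (.const 1))) (.const 1)) fun a l hl => ?_
  · simpa [e] using this
  · have hl := hl.length_le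
    rw [List.length_replicate] at hl
    rw [e]
    refine (treeSize_le_of_forall_le (c := treeSize (f a)) fun b hb => ?_).trans ?_
    · simp only [List.mem_reverse, List.mem_range] at hb
      simp only [treeSize_nat]; omega
    · gcongr
      simp only [treeSize_nat, List.length_reverse, List.length_range]; omega

end PolyFun

end

end ColorAvoiding

namespace ColorAvoiding

open Turing TreeCode StateTransition

/-! ### From program fragments to machines -/

/-- The initial state of the finite memory. -/
def initialRegister : Register := (.zero, false)

/-- The statements of the machine that runs a program fragment and halts. -/
def haltingCode (F : Frag) : Option F.Label → Stmt (Option F.Label)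
  | none => .load (fun _ => initialRegister) .halt
  | some l => F.code l

/-- The machine that runs a program fragment and then halts with output on the stack `k`. -/
def machine (F : Frag) (k : Option WorkStack) : FinTM2 where
  K := Option WorkStack
  k₀ := none
  k₁ := k
  Γ := Alphabet
  Λ := Option F.Label
  main := some F.entry
  σ := Register
  initialState := initialRegister
  Γk₀Fin := inferInstanceAs (Fintype Symbol)
  m := haltingCode F

/-- The exit of the fragment becomes an ordinary label of the machine, whose statement halts. -/
theorem Run.exists_steps {Λ : Type} {M : Λ → Stmt (Option Λ)} {M' : Option Λ → Stmt (Option Λ)}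
    (hM : ∀ l, M' (some l) = M l) {l v S v' S' t} (h : Run M l v S v' S' t) :
    ∃ s ≤ t, (flip bind (TM2.step M'))^[s] (some ⟨some l, v, S⟩) = some ⟨some none, v', S'⟩ := by
  induction h with
  | exit v S t => exact ⟨0, Nat.zero_le _, rfl⟩
  | @step l v S l' v₁ S₁ v' S' t hs _ ih =>
    obtain ⟨s, hst, h⟩ := ih
    refine ⟨s + 1, by omega, ?_⟩
    rw [Function.iterate_succ_apply, ← h, ← hs, ← hM]
    rfl

/-- The additional step resets the register and halts, as a final configuration must have the
initial register and no contents outside the output stack. -/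
theorem machine_outputs (F : Frag) (k : Option WorkStack) (w : List Symbol)
    (y : List (Alphabet k)) {w' y'} (hw : w' = w) (hy : y' = y) {t : ℕ}
    (h : F.Exec (store w [] [] [] []) (Function.update (fun _ => []) k y) t) :
    Nonempty (TM2OutputsInTime (machine F k) w' (some y') (t + 1)) := by
  subst hw hy
  obtain ⟨v', h⟩ := h initialRegister
  obtain ⟨s, hst, h⟩ := h.exists_steps (M' := haltingCode F) fun _ => rfl
  have hi : initList (machine F k) w' =
      (⟨some (some F.entry), initialRegister, store w' [] [] [] []⟩ : TM2.Cfg _ _ _) := by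
    simp only [initList, machine]
    congr 1
    funext k
    rcases k with _ | _ | _ | _ | _ <;> rfl
  have hh : haltList (machine F k) y' =
      (⟨none, initialRegister, Function.update (fun _ => []) k y'⟩ : TM2.Cfg _ _ _) := by
    simp only [haltList, machine]
    congr 1
    funext k'
    by_cases hk : k' = k
    · subst hk
      simp
      rfl
    · simp [hk]
  have hf : (flip bind (machine F k).step)^[s + 1] (initList (machine F k) w') =
      some (haltList (machine F k) y') := by
    rw [hi, hh, Function.iterate_succ_apply']
    exact (congrArg (fun c => bind c (TM2.step (haltingCode F))) h).trans rfl
  exact ⟨⟨⟨s + 1, hf⟩, Nat.succ_le_succ hst⟩⟩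

/-! ### Reading the input and writing the output -/

namespace Frag

/-- Push the tree of the head of the input stack. -/
def pushSymbol : Frag :=
  ite none (fun s => s = some .zero) (pushTree (tree Symbol.zero)) <|
  ite none (fun s => s = some .one) (pushTree (tree Symbol.one)) <|
  ite none (fun s => s = some .comma) (pushTree (tree Symbol.comma)) <|
  pushTree (tree Symbol.semicolon)

/-- The worst case is the semicolon: three tests and a tree of size 7. -/
theorem exec_pushSymbol (s : Symbol) (w : List Symbol) (m : List Bool) :
    pushSymbol.Exec (store (s :: w) m [] [] []) (store (s :: w) ((tree s).word ++ m) [] [] [])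
      10 := by
  have h := exec_pushTree (tree s) (s :: w) m
  cases s with
  | zero => exact (exec_ite_true rfl h).mono (by decide)
  | one => exact (exec_ite_false rfl (exec_ite_true rfl h)).mono (by decide)
  | comma => exact (exec_ite_false rfl (exec_ite_false rfl (exec_ite_true rfl h))).mono (by decide)
  | semicolon =>
    exact (exec_ite_false rfl (exec_ite_false rfl (exec_ite_false rfl h))).mono (by decide)

/-- Move the input word to the main stack, as the tree of the reversed list of its symbols. -/
def readInput : Frag :=
  seq (push false) <| loop none Option.isSome <| seq pushSymbol <|
    seq (block <| .pop none (fun v _ => v) <| .goto fun _ => none) (push true)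

/-- Per symbol: 10 steps to push its tree, and one each for removing it from the input, for the node
bit and for the test. The first symbol is deepest in the resulting list, hence the reversal. -/
theorem exec_readInput (w : List Symbol) :
    readInput.Exec (store w [] [] [] []) (store [] (tree w.reverse).word [] [] [])
      (13 * w.length + 2) := by
  have key : ∀ (w l : List Symbol), (loop none Option.isSome <| seq pushSymbol <|
      seq (block <| .pop none (fun v _ => v) <| .goto fun _ => none) (push true)).Exec
      (store w (tree l).word [] [] []) (store [] (tree (w.reverse ++ l)).word [] [] [])
      (13 * w.length + 1) := by
    intro w
    induction w with
    | nil => exact fun l => exec_loop_exit _ rfl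
    | cons s w ih =>
      intro l
      refine (exec_loop_step (S₁ := store w (tree (s :: l)).word [] [] []) rfl
        (exec_seq (exec_pushSymbol s w _) (exec_seq (t := 1)
          (S₁ := store w ((tree s).word ++ (tree l).word) [] [] [])
          (exec_block fun v => ⟨v, by simp⟩) (exec_push true _ _ _ _ _)))
        (by simpa using ih (s :: l))).mono ?_
      simp; omega
  refine (exec_seq (exec_push false _ _ _ _ _) (by simpa [BinTree.word] using key w [])).mono ?_
  omega

/-- Move a list of symbols from the main stack to the output stack, where it is reversed. -/
def writeOutput : Frag :=
  seq (loop (some .main) (fun b => b.getD false) <| block <|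
    .pop (some .main) (fun v _ => v) <| .pop (some .main) (fun v b => (v.1, b.getD false)) <|
    .branch (fun v => v.2) (.pop (some .main) (fun v _ => v) <|
      .pop (some .main) (fun v b => (v.1, b.getD false)) <|
      .branch (fun v => v.2) (.pop (some .main) (fun v _ => v) <|
        .pop (some .main) (fun v b => (v.1, b.getD false)) <|
        .branch (fun v => v.2) (.pop (some .main) (fun v _ => v) <|
          .pop (some .main) (fun v _ => v) <|
          .push none (fun _ => .semicolon) <| .goto fun _ => none)
        (.push none (fun _ => .comma) <| .goto fun _ => none))
      (.push none (fun _ => .one) <| .goto fun _ => none))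
    (.push none (fun _ => .zero) <| .goto fun _ => none)) (pop .main)

/-- The unary code of a symbol has at most 7 bits, so one nested statement decodes it in a single
step. -/
theorem exec_writeOutput (y : List Symbol) :
    writeOutput.Exec (store [] (tree y).word [] [] []) (store y.reverse [] [] [] [])
      (2 * y.length + 2) := by
  have key : ∀ (y w : List Symbol), ∀ q, (∀ (s : Symbol) y w v, ∃ v', TM2.stepAux q v
        (store w (true :: ((tree s).word ++ (tree y).word)) [] [] []) =
          ⟨some none, v', store (s :: w) (tree (α := List Symbol) y).word [] [] []⟩) →
      (loop (some .main) (fun b => b.getD false) (block q)).Exec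
      (store w (tree y).word [] [] []) (store (y.reverse ++ w) [false] [] [] [])
      (2 * y.length + 1) := by
    intro y w q hq
    induction y generalizing w with
    | nil => exact exec_loop_exit _ rfl
    | cons s y ih =>
      refine (exec_loop_step (t := 1) rfl (exec_block (hq s y w)) (by simpa using ih (s :: w))).mono
        ?_
      simp; omega
  refine (exec_seq (key y [] _ fun s y w v => ?_) ?_).mono (t := 2 * y.length + 1 + 1) le_rfl
  · cases s <;> simp [tree, Symbol.index, BinTree.word]
  · simpa using exec_pop false y.reverse [] [] [] []

/-- Replace the tree of a Boolean value by the value. -/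
def writeBool : Frag :=
  ite (some .main) (fun b => b.getD false)
    (seq (pop .main) <| seq (pop .main) <| seq (pop .main) (push true)) skip

theorem exec_writeBool (b : Bool) :
    writeBool.Exec (store [] (tree b).word [] [] []) (store [] [b] [] [] []) 5 := by
  cases b with
  | false => exact (exec_ite_false rfl (exec_skip _)).mono (by decide)
  | true =>
    exact exec_ite_true rfl (exec_seq (exec_pop _ _ _ _ _ _) <| exec_seq (exec_pop _ _ _ _ _ _) <|
      exec_seq (exec_pop _ _ _ _ _ _) (exec_push _ _ _ _ _ _))

end Frag

/-- The largest symbol tree has size 7, and each list node adds 1. -/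
theorem treeSize_symbols (w : List Symbol) : treeSize w ≤ 8 * w.length + 1 := by
  have := PolyFun.treeSize_le_of_forall_le (l := w) (c := 7) fun s _ => by cases s <;> decide
  omega

/-- If a function on words is computed in polynomial time on the trees that represent the words,
then a machine computes it in polynomial time on the words. -/
theorem PolyFun.polyTimeComputable {α β : Type} {ea : α → List Symbol} {eb : β → List Symbol}
    {f : α → β} {g : List Symbol → List Symbol} (hg : PolyFun g) (h : ∀ a, g (ea a) = eb (f a)) :
    PolyTimeComputable ea eb f := by
  -- Reading and writing each reverse the word, so the fragment in between has to compute the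
  -- conjugate of `g` by reversal.
  have hg' : PolyFun fun w : List Symbol => (g w.reverse).reverse :=
    list_reverse (hg.comp (list_reverse .id))
  obtain ⟨F, p, hF⟩ := hg'
  let G : Frag := .seq .readInput <| .seq F .writeOutput
  -- The factor 3 covers the fragment itself and two steps per output symbol, since the output
  -- length is also bounded by `p`; the inner polynomial bounds the tree of the input word.
  let P : Polynomial ℕ := .C 13 * .X + .C 5 + .C 3 * p.comp (.C 8 * .X + .C 1)
  have key : ∀ a, Nonempty (TM2OutputsInTime (machine G none)
      ((ea a).map (Equiv.refl Symbol).invFun) (some ((eb (f a)).map (Equiv.refl Symbol).invFun))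
      (P.eval (ea a).length)) := by
    intro a
    obtain ⟨hs, ht⟩ := hF (ea a).reverse
    simp only [List.reverse_reverse, h] at hs ht
    have h₁ : treeSize (ea a).reverse ≤ 8 * (ea a).length + 1 := by
      simpa using treeSize_symbols (ea a).reverse
    have h₂ := eval_mono p h₁
    have h₃ := length_lt_treeSize (eb (f a)).reverse
    obtain ⟨H⟩ := machine_outputs G none (ea a) (eb (f a)) (List.map_id _) (List.map_id _)
      (t := 13 * (ea a).length + 2 + (p.eval (treeSize (ea a).reverse) +
        (2 * (eb (f a)).reverse.length + 2))) <| by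
      refine Frag.exec_seq (Frag.exec_readInput _) (Frag.exec_seq (by simpa using ht [] []) ?_)
      convert Frag.exec_writeOutput (eb (f a)).reverse using 1
      funext k
      rcases k with _ | _ | _ | _ | _ <;> simp
    refine ⟨⟨H.toEvalsTo, H.steps_le_m.trans ?_⟩⟩
    simp only [P, Polynomial.eval_add, Polynomial.eval_mul, Polynomial.eval_comp,
      Polynomial.eval_C, Polynomial.eval_X]
    omega
  exact ⟨{
    tm := machine G none
    inputAlphabet := Equiv.refl _
    outputAlphabet := Equiv.refl _
    time := P
    outputsFun := fun a => (key a).some }⟩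

/-- A language is in P if membership is decided in polynomial time on the trees that represent the
words. -/
theorem PolyFun.inP {L : Language Symbol} {g : List Symbol → Bool} (hg : PolyFun g)
    (h : ∀ w, g w = true ↔ w ∈ L) : InP L := by
  classical
  have hg' : PolyFun fun w : List Symbol => g w.reverse := hg.comp (list_reverse .id)
  obtain ⟨F, p, hF⟩ := hg'
  let G : Frag := .seq .readInput <| .seq F .writeBool
  let P : Polynomial ℕ := .C 13 * .X + .C 8 + p.comp (.C 8 * .X + .C 1)
  have key : ∀ w : List Symbol, Nonempty (TM2OutputsInTime (machine G (some .main))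
      (w.map (Equiv.refl Symbol).invFun)
      (some ((Computability.encodeBool (decide (w ∈ L))).map (Equiv.refl Bool).invFun)) (P.eval w.length)) := by
    intro w
    have e : (Computability.encodeBool (decide (w ∈ L))).map (Equiv.refl Bool).invFun = [g w] := by
      rw [show decide (w ∈ L) = g w by rw [Bool.eq_iff_iff, decide_eq_true_iff, h]]
      rfl
    obtain ⟨hs, ht⟩ := hF w.reverse
    simp only [List.reverse_reverse] at hs ht
    have h₁ : treeSize w.reverse ≤ 8 * w.length + 1 := by
      simpa using treeSize_symbols w.reverse
    have h₂ := eval_mono p h₁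
    obtain ⟨H⟩ := machine_outputs G (some .main) w [g w] (List.map_id _) e
      (t := 13 * w.length + 2 + (p.eval (treeSize w.reverse) + 5)) <| by
      refine Frag.exec_seq (Frag.exec_readInput _) (Frag.exec_seq (by simpa using ht [] []) ?_)
      convert Frag.exec_writeBool (g w) using 1
      funext k
      rcases k with _ | _ | _ | _ | _ <;> simp
    refine ⟨⟨H.toEvalsTo, H.steps_le_m.trans ?_⟩⟩
    simp only [P, Polynomial.eval_add, Polynomial.eval_mul, Polynomial.eval_comp,
      Polynomial.eval_C, Polynomial.eval_X]
    omega
  exact ⟨{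
    tm := machine G (some .main)
    inputAlphabet := Equiv.refl _
    outputAlphabet := Equiv.refl _
    time := P
    outputsFun := fun w => by convert (key w).some <;> rfl }⟩

end ColorAvoiding

namespace ColorAvoiding

open TreeCode

/-! ### The algorithm -/

/-- An edge-colored graph whose vertices and colors are natural numbers: the numbers of vertices
and colors, and the list of the edges. -/
abbrev RawGraph := ℕ × ℕ × List (ℕ × ℕ × List ℕ)

namespace RawGraph

/-- The vertices that are in `S` or have a neighbor in `S` after the removal of color `i`. -/
def reachStep (g : RawGraph) (i : ℕ) (S : List ℕ) : List ℕ :=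
  (List.range g.1).filter fun v => (S.any fun x => x == v) || g.2.2.any fun e =>
    !(e.2.2.any fun c => c == i) &&
      (((S.any fun x => x == e.1) && e.2.1 == v) || ((S.any fun x => x == e.2.1) && e.1 == v))

/-- The vertices that are reachable from `u` after the removal of color `i`. -/
def reach (g : RawGraph) (i u : ℕ) : List ℕ :=
  (List.range g.1).foldl (fun S _ => reachStep g i S) [u]

/-- The test for color-avoiding connectivity. -/
def connected (g : RawGraph) (u v : ℕ) : Bool :=
  (List.range g.2.1).all fun i => (reach g i u).any fun x => x == v

/-- The component of a vertex. -/
def component (g : RawGraph) (v : ℕ) : List ℕ :=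
  (List.range g.1).filter fun u => connected g v u

/-- The list of the components. -/
def components (g : RawGraph) : List (List ℕ) :=
  ((List.range g.1).filter fun v => (List.range v).all fun u => !connected g v u).map fun v =>
    component g v

/-- The names of vertices and colors are in the range. -/
def inRange (g : RawGraph) : Bool :=
  g.2.2.all fun e => decide (e.1 < g.1) && decide (e.2.1 < g.1) && e.2.2.all fun c =>
    decide (c < g.2.1)

/-- No edge is a loop. -/
def loopless (g : RawGraph) : Bool :=
  g.2.2.all fun e => !(e.1 == e.2.1)

/-- No two edges have the same ends. -/
def noMultipleEdges (g : RawGraph) : Bool :=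
  g.2.2.all fun e => decide ((g.2.2.filter fun e' =>
    (e'.1 == e.1 && e'.2.1 == e.2.1) || (e'.1 == e.2.1 && e'.2.1 == e.1)).length ≤ 1)

/-- Every edge has exactly one color. -/
def singleColored (g : RawGraph) : Bool :=
  g.2.2.all fun e => e.2.2.length == 1

end RawGraph

open RawGraph

/-- The word of an edge, without the semicolon. -/
def edgeWord (e : ℕ × ℕ × List ℕ) : List Symbol :=
  unary e.1 ++ Symbol.comma :: (unary e.2.1 ++ e.2.2.flatMap fun c => Symbol.comma :: unary c)

/-- The word of a graph. -/
def graphWord (g : RawGraph) : List Symbol :=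
  unary g.1 ++ Symbol.semicolon :: (unary g.2.1 ++ Symbol.semicolon ::
    g.2.2.flatMap fun e => edgeWord e ++ [Symbol.semicolon])

/-- The parts of a word between the occurrences of a symbol. -/
def fields (s : Symbol) (w : List Symbol) : List (List Symbol) :=
  w.foldr (fun c l => bif c.index == s.index then [] :: l else (c :: l.headD []) :: l.tail) [[]]

/-- The edge of a word without semicolon. -/
def parseEdge (w : List Symbol) : ℕ × ℕ × List ℕ :=
  (((fields .comma w).headD []).length, ((fields .comma w).tail.headD []).length,
    (fields .comma w).tail.tail.map fun x => x.length)

/-- The graph of a word that is given by its parts between the semicolons. -/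
def parseGraph (l : List (List Symbol)) : RawGraph :=
  ((l.headD []).length, (l.tail.headD []).length,
    l.tail.tail.reverse.tail.reverse.map fun w => parseEdge w)

/-- The value of a binary numeral, the least significant digit first. -/
def binaryValue (w : List Symbol) : ℕ :=
  w.foldr (fun c v => v + v + c.index) 0

/-- The minimum of `N` and the value of a binary numeral. -/
def cappedValue (N : ℕ) (w : List Symbol) : ℕ :=
  w.foldr (fun c v => bif decide (v + v + c.index ≤ N) then v + v + c.index else N) 0

/-- The word is the binary representation of a positive number. -/
def isPositiveNumeral (w : List Symbol) : Bool :=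
  (w.all fun c => decide (c.index ≤ 1)) && ((w.reverse.headD Symbol.zero).index == 1)

/-- A step in the comparison of two words: `c` is compared with the first symbol of the rest of the
other word. -/
def sameWordStep (p : Bool × List Symbol) (c : Symbol) : Bool × List Symbol :=
  (p.1 && !p.2.isEmpty && (c.index == (p.2.headD Symbol.zero).index), p.2.tail)

/-- Equality of words. -/
def sameWord (w w' : List Symbol) : Bool :=
  let p := w.foldl sameWordStep (true, w')
  p.1 && p.2.isEmpty

/-- The decision algorithm. -/
def accepts (admissible : RawGraph → Bool) (w : List Symbol) : Bool :=
  let b := (fields .semicolon w).headD []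
  let g := parseGraph (fields .semicolon w).tail
  isPositiveNumeral b && sameWord w (b ++ Symbol.semicolon :: graphWord g) && inRange g &&
    admissible g && (List.range g.1).any fun v =>
      decide (cappedValue (g.1 + 1) b ≤ (component g v).length)

/-! ### Polynomial running time of the algorithm -/

namespace PolyFun

variable {α : Type} [TreeCode α]

theorem reachStep {g : α → RawGraph} {i : α → ℕ} {S : α → List ℕ} (hg : PolyFun g)
    (hi : PolyFun i) (hS : PolyFun S) : PolyFun fun a => RawGraph.reachStep (g a) (i a) (S a) := by
  unfold RawGraph.reachStep
  fun_prop

theorem treeSize_filter {β : Type} [TreeCode β] (p : β → Bool) (l : List β) :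
    treeSize (l.filter p) ≤ treeSize l := by
  induction l with
  | nil => simp
  | cons b l ih => cases h : p b <;> simp [h] <;> omega

-- The searched set cannot grow beyond control: after any positive number of rounds it is a filtered
-- list of the vertices.
@[fun_prop]
theorem reach {g : α → RawGraph} {i u : α → ℕ} (hg : PolyFun g)
    (hi : PolyFun i) (hu : PolyFun u) : PolyFun fun a => RawGraph.reach (g a) (i a) (u a) := by
  have hI : PolyFun fun a => [u a] := by fun_prop
  have hR : PolyFun fun a => List.range (g a).1 := by fun_prop
  refine list_foldl hR hI (g := fun a S _ => RawGraph.reachStep (g a) (i a) S)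
    (reachStep (by fun_prop) (by fun_prop) (by fun_prop)) (hI.bounded.add hR.bounded)
    fun a l _ => ?_
  induction l using List.reverseRecOn with
  | nil => exact Nat.le_add_right _ _
  | append_singleton l x _ =>
    rw [List.foldl_append]
    exact (treeSize_filter _ _).trans (Nat.le_add_left _ _)

@[fun_prop]
theorem connected {g : α → RawGraph} {u v : α → ℕ} (hg : PolyFun g)
    (hu : PolyFun u) (hv : PolyFun v) : PolyFun fun a => RawGraph.connected (g a) (u a) (v a) := by
  unfold RawGraph.connected
  fun_prop

@[fun_prop]
theorem component {g : α → RawGraph} {v : α → ℕ} (hg : PolyFun g) (hv : PolyFun v) :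
    PolyFun fun a => RawGraph.component (g a) (v a) := by
  unfold RawGraph.component
  fun_prop

@[fun_prop]
theorem components {g : α → RawGraph} (hg : PolyFun g) :
    PolyFun fun a => RawGraph.components (g a) := by
  unfold RawGraph.components
  fun_prop

@[fun_prop]
theorem inRange {g : α → RawGraph} (hg : PolyFun g) : PolyFun fun a => RawGraph.inRange (g a) := by
  unfold RawGraph.inRange
  fun_prop

@[fun_prop]
theorem loopless {g : α → RawGraph} (hg : PolyFun g) :
    PolyFun fun a => RawGraph.loopless (g a) := by
  unfold RawGraph.loopless
  fun_prop

@[fun_prop]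
theorem noMultipleEdges {g : α → RawGraph} (hg : PolyFun g) :
    PolyFun fun a => RawGraph.noMultipleEdges (g a) := by
  unfold RawGraph.noMultipleEdges
  fun_prop

@[fun_prop]
theorem singleColored {g : α → RawGraph} (hg : PolyFun g) :
    PolyFun fun a => RawGraph.singleColored (g a) := by
  unfold RawGraph.singleColored
  fun_prop

@[fun_prop]
theorem index {c : α → Symbol} (hc : PolyFun c) : PolyFun fun a => (c a).index :=
  comp (of_tree_eq fun _ => rfl) hc

@[fun_prop]
theorem unary {f : α → ℕ} (hf : PolyFun f) : PolyFun fun a => ColorAvoiding.unary (f a) := by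
  have : PolyFun fun a => (List.replicate (f a) ()).map fun _ => Symbol.one := by fun_prop
  simpa [ColorAvoiding.unary] using this

@[fun_prop]
theorem edgeWord {e : α → ℕ × ℕ × List ℕ} (he : PolyFun e) :
    PolyFun fun a => ColorAvoiding.edgeWord (e a) := by
  unfold ColorAvoiding.edgeWord
  fun_prop

@[fun_prop]
theorem graphWord {g : α → RawGraph} (hg : PolyFun g) :
    PolyFun fun a => ColorAvoiding.graphWord (g a) := by
  unfold ColorAvoiding.graphWord
  fun_prop

@[fun_prop]
theorem encodeLists {L : α → List (List ℕ)} (hL : PolyFun L) :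
    PolyFun fun a => ColorAvoiding.encodeLists (L a) := by
  unfold ColorAvoiding.encodeLists
  fun_prop

@[fun_prop]
theorem fields (s : Symbol) {w : α → List Symbol} (hw : PolyFun w) :
    PolyFun fun a => ColorAvoiding.fields s (w a) := by
  refine list_foldr_of_growth (g := fun _ (c : Symbol) (l : List (List Symbol)) =>
    bif c.index == s.index then [] :: l else (c :: l.headD []) :: l.tail) hw (const _)
    (by fun_prop) (q := fun x => treeSize x + 2) (.add .treeSize (.const 2)) fun a l c => ?_
  cases h : c.index == s.index <;> cases l <;> (simp; omega)

@[fun_prop]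
theorem parseEdge {w : α → List Symbol} (hw : PolyFun w) :
    PolyFun fun a => ColorAvoiding.parseEdge (w a) := by
  unfold ColorAvoiding.parseEdge
  fun_prop

@[fun_prop]
theorem parseGraph {l : α → List (List Symbol)} (hl : PolyFun l) :
    PolyFun fun a => ColorAvoiding.parseGraph (l a) := by
  unfold ColorAvoiding.parseGraph
  fun_prop

-- The cap keeps the unary value at most `N`; without it the doubling would yield exponentially
-- large trees.
@[fun_prop]
theorem cappedValue {N : α → ℕ} {w : α → List Symbol} (hN : PolyFun N) (hw : PolyFun w) :
    PolyFun fun a => ColorAvoiding.cappedValue (N a) (w a) := by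
  refine list_foldr_of_growth (g := fun a (c : Symbol) (v : ℕ) =>
    bif decide (v + v + c.index ≤ N a) then v + v + c.index else N a) hw (const _)
    (by fun_prop) (q := fun x : α × Symbol => treeSize (N x.1)) (hN.comp fst).bounded
    fun a v c => ?_
  by_cases h : v + v + c.index ≤ N a <;> (simp [h, treeSize_nat]; try omega)

@[fun_prop]
theorem isPositiveNumeral {w : α → List Symbol} (hw : PolyFun w) :
    PolyFun fun a => ColorAvoiding.isPositiveNumeral (w a) := by
  unfold ColorAvoiding.isPositiveNumeral
  fun_prop

@[fun_prop]
theorem sameWord {w w' : α → List Symbol} (hw : PolyFun w) (hw' : PolyFun w') :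
    PolyFun fun a => ColorAvoiding.sameWord (w a) (w' a) := by
  have : PolyFun fun a => (w a).foldl sameWordStep (true, w' a) := by
    refine list_foldl_of_growth (g := fun _ => sameWordStep) (I := fun a => (true, w' a)) hw
      (by fun_prop) (by unfold sameWordStep; fun_prop) (.const 3) fun a p c => ?_
    obtain ⟨b, l⟩ := p
    have h := treeSize_bool (b && !l.isEmpty && (c.index == (l.headD Symbol.zero).index))
    have h' : treeSize l.tail ≤ treeSize l := by
      cases l with
      | nil => simp
      | cons c l => simp; omega
    simp only [sameWordStep, treeSize_pair]
    omega
  unfold ColorAvoiding.sameWord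
  fun_prop

theorem accepts {admissible : RawGraph → Bool} (h : PolyFun admissible) :
    PolyFun fun w => ColorAvoiding.accepts admissible w := by
  unfold ColorAvoiding.accepts
  fun_prop

end PolyFun

end ColorAvoiding

namespace ColorAvoiding

/-! ### Correctness of the graph algorithms -/

theorem equivalence_colorAvoidingConnected {V E C : Type*} (G : ColoredGraph V E C) :
    Equivalence G.ColorAvoidingConnected where
  refl _ _ := SimpleGraph.Reachable.refl _
  symm h i := (h i).symm
  trans h h' i := (h i).trans (h' i)

namespace EdgeList

/-- The edge list with natural numbers as names. -/
def raw (I : EdgeList) : RawGraph :=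
  (I.n, I.k, I.edges.map fun e => (e.1.val, e.2.1.val, e.2.2.map Fin.val))

variable (I : EdgeList)

theorem exists_ends_iff (i : Fin I.k) (y x : Fin I.n) :
    (∃ j, I.graph.ends j = s(y, x) ∧ i ∉ I.graph.colors j) ↔
      ∃ e ∈ I.edges, s(e.1, e.2.1) = s(y, x) ∧ i ∉ e.2.2 := by
  constructor
  · rintro ⟨j, h, h'⟩
    exact ⟨_, List.get_mem I.edges j, h, h'⟩
  · rintro ⟨e, he, h, h'⟩
    obtain ⟨j, rfl⟩ := List.get_of_mem he
    exact ⟨j, h, h'⟩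

theorem mem_reachStep (i : Fin I.k) (S : List ℕ) (x : Fin I.n) :
    (x : ℕ) ∈ I.raw.reachStep i S ↔ (x : ℕ) ∈ S ∨
      ∃ y : Fin I.n, (y : ℕ) ∈ S ∧ ∃ j, I.graph.ends j = s(y, x) ∧ i ∉ I.graph.colors j := by
  simp only [exists_ends_iff]
  simp only [RawGraph.reachStep, raw, List.mem_filter, List.mem_range, x.isLt, true_and,
    Bool.or_eq_true, Bool.and_eq_true, Bool.not_eq_true', List.any_eq_true, List.any_eq_false,
    beq_iff_eq, List.mem_map, exists_exists_and_eq_and, exists_eq_right, forall_exists_index,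
    and_imp, forall_apply_eq_imp_iff₂, Fin.val_inj]
  refine or_congr Iff.rfl ⟨?_, ?_⟩
  · rintro ⟨e, he, hc, ⟨h, h'⟩ | ⟨h, h'⟩⟩
    · exact ⟨e.1, h, e, he, by rw [h'], fun hi => hc i hi rfl⟩
    · exact ⟨e.2.1, h, e, he, by rw [h', Sym2.eq_swap], fun hi => hc i hi rfl⟩
  · rintro ⟨y, hy, e, he, h, hi⟩
    refine ⟨e, he, fun c hc hci => hi (hci ▸ hc), ?_⟩
    rcases Sym2.eq_iff.1 h with ⟨h₁, h₂⟩ | ⟨h₁, h₂⟩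
    · exact .inl ⟨h₁ ▸ hy, h₂⟩
    · exact .inr ⟨h₂ ▸ hy, h₁⟩

/-- After `j` rounds the list contains only vertices reachable from `u`, and all those with a walk
of length at most `j` to `u`. -/
theorem mem_reach (i : Fin I.k) (u x : Fin I.n) :
    (x : ℕ) ∈ I.raw.reach i u ↔ I.graph.AvoidingConnected i u x := by
  have hs : ∀ j, (List.range (j + 1)).foldl (fun S _ => I.raw.reachStep i S) [(u : ℕ)] =
      I.raw.reachStep i ((List.range j).foldl (fun S _ => I.raw.reachStep i S) [(u : ℕ)]) :=
    fun j => by rw [List.range_succ, List.foldl_append]; rfl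
  constructor
  · have key : ∀ (j : ℕ) (v : Fin I.n),
        (v : ℕ) ∈ (List.range j).foldl (fun S _ => I.raw.reachStep i S) [(u : ℕ)] →
          I.graph.AvoidingConnected i u v := by
      intro j
      induction j with
      | zero =>
        intro v hv
        rw [Fin.ext (List.mem_singleton.1 hv)]
        exact SimpleGraph.Reachable.refl _
      | succ j ih =>
        intro v hv
        rw [hs, mem_reachStep] at hv
        rcases hv with hv | ⟨y, hy, he⟩
        · exact ih v hv
        -- A loop is not an adjacency of the remaining graph, but it adds no new vertex either.
        · by_cases hyv : y = v
          · exact hyv ▸ ih y hy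
          · exact (ih y hy).trans (SimpleGraph.Adj.reachable ⟨hyv, he⟩)
    exact key _ x
  · intro h
    -- Walks are directed towards `u`, so that removing the first edge leaves a shorter walk to the
    -- start of the search.
    obtain ⟨p, hp⟩ := h.symm.exists_isPath
    have key : ∀ (j : ℕ) (v : Fin I.n) (p : (I.graph.remaining i).Walk v u), p.length ≤ j →
        (v : ℕ) ∈ (List.range j).foldl (fun S _ => I.raw.reachStep i S) [(u : ℕ)] := by
      intro j
      induction j with
      | zero =>
        intro v p hp
        cases p with
        | nil => simp
        | cons => simp at hp
      | succ j ih =>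
        intro v p hp
        rw [hs, mem_reachStep]
        cases p with
        | nil => exact .inl (ih _ .nil (Nat.zero_le _))
        | @cons _ w _ h p =>
          refine .inr ⟨w, ih w p (by simpa using hp), ?_⟩
          exact h.symm.2
    -- A path visits no vertex twice, so it has fewer than `n` edges.
    exact key _ _ p (hp.length_lt.trans_eq (Fintype.card_fin _)).le

theorem connected_iff (u v : Fin I.n) :
    I.raw.connected u v = true ↔ I.graph.ColorAvoidingConnected u v := by
  simp only [RawGraph.connected, List.all_eq_true, List.any_eq_true, beq_iff_eq, exists_eq_right]
  constructor
  · exact fun h i => (I.mem_reach i u v).1 (h i (List.mem_range.2 i.isLt))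
  · exact fun h i hi => (I.mem_reach ⟨i, List.mem_range.1 hi⟩ u v).2 (h _)

open Classical in
/-- The component of a vertex, as a list. -/
noncomputable def component (v : Fin I.n) : List (Fin I.n) :=
  (List.finRange I.n).filter fun u => I.graph.ColorAvoidingConnected v u

open Classical in
/-- The list of the components. -/
noncomputable def components : List (List (Fin I.n)) :=
  ((List.finRange I.n).filter fun v => ∀ u < v, ¬I.graph.ColorAvoidingConnected v u).map
    I.component

theorem mem_component (v u : Fin I.n) :
    u ∈ I.component v ↔ I.graph.ColorAvoidingConnected v u := by
  simp [component]

theorem nodup_component (v : Fin I.n) : (I.component v).Nodup :=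
  (List.nodup_finRange _).filter _

open Classical in
theorem raw_component (v : Fin I.n) :
    I.raw.component v = (I.component v).map Fin.val := by
  rw [RawGraph.component, component, show I.raw.1 = I.n from rfl, ← List.map_coe_finRange_eq_range,
    List.filter_map]
  congr 1
  refine List.filter_congr fun u _ => ?_
  rw [Bool.eq_iff_iff, Function.comp, connected_iff, decide_eq_true_iff]

open Classical in
theorem raw_components : I.raw.components = I.components.map fun l => l.map Fin.val := by
  rw [RawGraph.components, components, show I.raw.1 = I.n from rfl,
    ← List.map_coe_finRange_eq_range, List.filter_map, List.map_map, List.map_map]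
  refine (List.map_congr_left fun v _ => I.raw_component v).trans ?_
  congr 1
  refine List.filter_congr fun v _ => ?_
  rw [Bool.eq_iff_iff, Function.comp, decide_eq_true_iff]
  simp only [List.all_eq_true, List.mem_range, Bool.not_eq_true']
  constructor
  · intro h u hu hvu
    have := h u hu
    rw [(I.connected_iff v u).2 hvu] at this
    cases this
  · intro h u hu
    rw [Bool.eq_false_iff, Ne, I.connected_iff v ⟨u, hu.trans v.isLt⟩]
    exact h _ hu

-- The listed vertices are those that are least in their class. If the lists of two such vertices `v
-- < w` met, then `w` would be equivalent to the smaller `v`; conversely every class has a least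
-- vertex.
open Classical in
theorem listsComponents_components : I.ListsComponents I.components := by
  have eqv := equivalence_colorAvoidingConnected I.graph
  have hset : ∀ v, {u | u ∈ I.component v} = {u | I.graph.ColorAvoidingConnected v u} := by
    intro v
    ext u
    exact I.mem_component v u
  refine ⟨List.nodup_flatten.2 ⟨?_, ?_⟩, fun S => ⟨?_, ?_⟩⟩
  · intro l hl
    obtain ⟨v, -, rfl⟩ := List.mem_map.1 hl
    exact I.nodup_component v
  · refine List.pairwise_map.2 (((List.pairwise_lt_finRange I.n).filter _).imp_of_mem ?_)
    intro v w _ hw hvw x hx hx'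
    have hw' := (List.mem_filter.1 hw).2
    rw [decide_eq_true_iff] at hw'
    rw [mem_component] at hx hx'
    exact hw' v hvw (eqv.trans hx' (eqv.symm hx))
  · rintro ⟨v, rfl⟩
    obtain ⟨u, hu, hmin⟩ := WellFounded.has_min (wellFounded_lt (α := Fin I.n))
      {u | I.graph.ColorAvoidingConnected v u} ⟨v, eqv.refl v⟩
    refine ⟨I.component u, List.mem_map_of_mem (List.mem_filter.2 ⟨List.mem_finRange _, ?_⟩), ?_⟩
    · rw [decide_eq_true_iff]
      exact fun w hw h => hmin w (eqv.trans hu h) hw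
    · rw [hset]
      ext w
      exact ⟨fun h => eqv.trans hu h, fun h => eqv.trans (eqv.symm hu) h⟩
  · rintro ⟨l, hl, rfl⟩
    obtain ⟨v, -, rfl⟩ := List.mem_map.1 hl
    exact ⟨v, hset v⟩

theorem exists_isComponent_iff (l : ℕ) :
    (∃ S, I.graph.IsComponent S ∧ l ≤ S.ncard) ↔
      ∃ v ∈ List.range I.n, l ≤ (I.raw.component v).length := by
  have hcard : ∀ v, {u | I.graph.ColorAvoidingConnected v u}.ncard =
      (I.raw.component v).length := by
    intro v
    rw [raw_component, List.length_map, ← List.toFinset_card_of_nodup (I.nodup_component v),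
      ← Set.ncard_coe_finset]
    congr 1
    ext u
    simp [mem_component]
  constructor
  · rintro ⟨_, ⟨v, rfl⟩, h⟩
    exact ⟨v, List.mem_range.2 v.isLt, hcard v ▸ h⟩
  · rintro ⟨v, hv, h⟩
    refine ⟨_, ⟨⟨v, List.mem_range.1 hv⟩, rfl⟩, ?_⟩
    rw [hcard]
    exact h

theorem raw_loopless : I.raw.loopless = true ↔ I.Loopless := by
  simp only [RawGraph.loopless, raw, Loopless, List.all_map, List.all_eq_true, Function.comp,
    Bool.not_eq_true', beq_eq_false_iff_ne, ne_eq, Fin.val_inj]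
  constructor
  · exact fun h j hj => h _ (List.get_mem I.edges j) (Sym2.mk_isDiag_iff.1 hj)
  · intro h e he
    obtain ⟨j, rfl⟩ := List.get_of_mem he
    exact fun h' => h j (Sym2.mk_isDiag_iff.2 h')

/-- Injectivity means that no unordered pair occurs twice in the list of ends, and only pairs that
do occur need a test. Each edge counts itself, hence the threshold 1. -/
theorem raw_noMultipleEdges :
    I.raw.noMultipleEdges = true ↔ Function.Injective I.graph.ends := by
  have h : List.ofFn I.graph.ends = I.edges.map fun e => s(e.1, e.2.1) := by
    conv_rhs => rw [← List.ofFn_get I.edges, List.map_ofFn]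
    rfl
  rw [← List.nodup_ofFn, h, List.nodup_iff_count_le_one]
  have hc : ∀ e : Fin I.n × Fin I.n × List (Fin I.k),
      (I.edges.map fun e => s(e.1, e.2.1)).count s(e.1, e.2.1) =
        (I.raw.2.2.filter fun e' => (e'.1 == e.1.val && e'.2.1 == e.2.1.val) ||
          (e'.1 == e.2.1.val && e'.2.1 == e.1.val)).length := by
    intro e
    rw [raw, List.filter_map, List.length_map, ← List.countP_eq_length_filter, List.count,
      List.countP_map]
    refine List.countP_congr fun e' _ => ?_
    simp only [Function.comp, beq_iff_eq, Sym2.eq_iff, Bool.or_eq_true, Bool.and_eq_true,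
      Fin.val_inj]
  simp only [RawGraph.noMultipleEdges, List.all_eq_true, decide_eq_true_iff]
  constructor
  · intro hr a
    by_cases ha : a ∈ I.edges.map fun e => s(e.1, e.2.1)
    · obtain ⟨e, he, rfl⟩ := List.mem_map.1 ha
      rw [hc]
      exact hr _ (List.mem_map_of_mem he)
    · rw [List.count_eq_zero_of_not_mem ha]
      exact Nat.zero_le _
  · intro hr e he
    obtain ⟨e, -, rfl⟩ := List.mem_map.1 he
    exact (hc e).symm.trans_le (hr _)

theorem raw_singleColored : I.raw.singleColored = true ↔ I.SingleColored := by
  simp [RawGraph.singleColored, raw, SingleColored, List.length_eq_one_iff]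

/-- The range test is what separates the parsed data that come from an actual graph from those that
do not. -/
theorem exists_raw_eq_iff (g : RawGraph) : (∃ I : EdgeList, I.raw = g) ↔ g.inRange = true := by
  obtain ⟨n, k, E⟩ := g
  simp only [RawGraph.inRange, List.all_eq_true, Bool.and_eq_true, decide_eq_true_iff]
  constructor
  · rintro ⟨I, h⟩ e he
    simp only [raw, Prod.mk.injEq] at h
    obtain ⟨rfl, rfl, rfl⟩ := h
    obtain ⟨e, -, rfl⟩ := List.mem_map.1 he
    refine ⟨⟨e.1.isLt, e.2.1.isLt⟩, fun c hc => ?_⟩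
    obtain ⟨c, -, rfl⟩ := List.mem_map.1 hc
    exact c.isLt
  · intro h
    have : E ∈ Set.range (List.map fun e : Fin n × Fin n × List (Fin k) =>
        (e.1.val, e.2.1.val, e.2.2.map Fin.val)) := by
      rw [Set.range_list_map]
      rintro ⟨u, v, cs⟩ he
      obtain ⟨⟨hu, hv⟩, hc⟩ := h _ he
      have : cs ∈ Set.range (List.map (Fin.val : Fin k → ℕ)) := by
        rw [Set.range_list_map]
        exact fun c hc' => ⟨⟨c, hc c hc'⟩, rfl⟩
      obtain ⟨cs, rfl⟩ := this
      exact ⟨(⟨u, hu⟩, ⟨v, hv⟩, cs), rfl⟩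
    obtain ⟨E, rfl⟩ := this
    exact ⟨⟨n, k, E⟩, rfl⟩

theorem encodeGraph_eq : encodeGraph I = graphWord I.raw := by
  simp only [encodeGraph, graphWord, raw, List.flatMap_map, List.append_assoc, List.cons_append]
  congr 4
  refine congrArg (fun f => I.edges.flatMap f) (funext fun e => ?_)
  simp [encodeEdge, edgeWord, List.flatMap_map, List.flatMap_assoc]

end EdgeList

/-! ### Correctness of the parser -/

theorem Symbol.index_injective : Function.Injective Symbol.index := by
  intro a b h
  cases a <;> cases b <;> first | rfl | cases h

theorem fields_cons (s c : Symbol) (w : List Symbol) : fields s (c :: w) =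
    bif c.index == s.index then [] :: fields s w
      else (c :: (fields s w).headD []) :: (fields s w).tail := rfl

theorem fields_append {s : Symbol} {x : List Symbol} (hx : s ∉ x) (y : List Symbol) :
    fields s (x ++ s :: y) = x :: fields s y := by
  induction x with
  | nil => simp [fields_cons]
  | cons c x ih =>
    rw [List.mem_cons, not_or] at hx
    have hc : (c.index == s.index) = false := by
      simpa using fun h => hx.1 (Symbol.index_injective h).symm
    simp [fields_cons, hc, ih hx.2]

theorem fields_of_notMem {s : Symbol} {x : List Symbol} (hx : s ∉ x) : fields s x = [x] := by
  induction x with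
  | nil => rfl
  | cons c x ih =>
    rw [List.mem_cons, not_or] at hx
    have hc : (c.index == s.index) = false := by
      simpa using fun h => hx.1 (Symbol.index_injective h).symm
    simp [fields_cons, hc, ih hx.2]

theorem notMem_unary {s : Symbol} (hs : s ≠ .one) (m : ℕ) : s ∉ unary m := by
  simp [unary, hs]

theorem semicolon_notMem_edgeWord (e : ℕ × ℕ × List ℕ) : Symbol.semicolon ∉ edgeWord e := by
  simp [edgeWord, unary]

theorem parseEdge_edgeWord (e : ℕ × ℕ × List ℕ) : parseEdge (edgeWord e) = e := by
  have key : ∀ (cs : List ℕ) (m : ℕ),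
      fields .comma (unary m ++ cs.flatMap fun c => Symbol.comma :: unary c) =
        unary m :: cs.map unary := by
    intro cs
    induction cs with
    | nil => exact fun m => by simpa using fields_of_notMem (notMem_unary (by simp) m)
    | cons c cs ih =>
      intro m
      simp only [List.flatMap_cons, List.cons_append]
      rw [fields_append (notMem_unary (by simp) m), ih]
      rfl
  have h : fields .comma (edgeWord e) = unary e.1 :: unary e.2.1 :: e.2.2.map unary := by
    rw [edgeWord, fields_append (notMem_unary (by simp) _), key]
  rw [parseEdge, h]
  simp [unary, Function.comp_def]

/-- Every edge ends with a semicolon, so the last field is empty; the parser drops it. -/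
theorem parseGraph_graphWord (g : RawGraph) :
    parseGraph (fields .semicolon (graphWord g)) = g := by
  have key : ∀ E : List (ℕ × ℕ × List ℕ),
      fields .semicolon (E.flatMap fun e => edgeWord e ++ [Symbol.semicolon]) =
        E.map edgeWord ++ [[]] := by
    intro E
    induction E with
    | nil => rfl
    | cons e E ih =>
      rw [List.flatMap_cons, List.append_assoc, List.singleton_append,
        fields_append (semicolon_notMem_edgeWord e), ih]
      rfl
  rw [parseGraph, graphWord, fields_append (notMem_unary (by simp) _),
    fields_append (notMem_unary (by simp) _), key]
  simp [unary, Function.comp_def, parseEdge_edgeWord]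

theorem sameWord_iff (w w' : List Symbol) : sameWord w w' = true ↔ w = w' := by
  have key : ∀ (w w' : List Symbol) (b : Bool), ((w.foldl sameWordStep (b, w')).1 &&
      (w.foldl sameWordStep (b, w')).2.isEmpty) = true ↔ b = true ∧ w = w' := by
    intro w
    induction w with
    | nil => intro w' b; cases w' <;> simp
    | cons c w ih =>
      intro w' b
      rw [List.foldl_cons, ih]
      cases w' with
      | nil => simp [sameWordStep]
      | cons c' w' => simp [sameWordStep, Symbol.index_injective.eq_iff, and_assoc]
  exact (key w w' true).trans (by simp)

/-- Doubling and adding a digit never decreases a value, so capping after every digit has the same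
effect as capping once at the end. -/
theorem cappedValue_eq (N : ℕ) (w : List Symbol) : cappedValue N w = min N (binaryValue w) := by
  induction w with
  | nil => simp [cappedValue, binaryValue]
  | cons c w ih =>
    simp only [cappedValue, binaryValue, List.foldr_cons] at ih ⊢
    rw [ih]
    generalize List.foldr _ 0 w = v
    by_cases h : min N v + min N v + c.index ≤ N <;> simp [h] <;> omega

theorem binaryValue_cons (c : Symbol) (w : List Symbol) :
    binaryValue (c :: w) = binaryValue w + binaryValue w + c.index := rfl

theorem binary_bit (b : Bool) (m : ℕ) (h : m = 0 → b = true) :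
    binary (Nat.bit b m) = (if b then .one else .zero) :: binary m := by
  rw [binary, Nat.bits_append_bit m b h]
  rfl

theorem isPositiveNumeral_cons_cons (c d : Symbol) (w : List Symbol) :
    isPositiveNumeral (c :: d :: w) = (decide (c.index ≤ 1) && isPositiveNumeral (d :: w)) := by
  have : ((d :: w).reverse ++ [c]).headD Symbol.zero = (d :: w).reverse.headD Symbol.zero := by
    cases h : (d :: w).reverse with
    | nil => simp at h
    | cons => rfl
  rw [isPositiveNumeral, isPositiveNumeral, List.reverse_cons, this, List.all_cons, Bool.and_assoc]

theorem isPositiveNumeral_binary {l : ℕ} (hl : 0 < l) :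
    isPositiveNumeral (binary l) = true ∧ binaryValue (binary l) = l := by
  induction l using Nat.strongRecOn with
  | ind l ih =>
    obtain ⟨b, m, rfl⟩ : ∃ b m, l = Nat.bit b m := ⟨_, _, (Nat.bit_bodd_div2 l).symm⟩
    have hv : Nat.bit b m = m + m + (if b then Symbol.one else Symbol.zero).index := by
      cases b <;> simp [Nat.bit, Symbol.index] <;> omega
    have hi : (if b then Symbol.one else Symbol.zero).index ≤ 1 := by
      cases b <;> simp [Symbol.index]
    rcases Nat.eq_zero_or_pos m with rfl | hm
    · cases b with
      | false => simp [Nat.bit] at hl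
      | true => rw [binary_bit _ _ fun _ => rfl]; simp [binary, isPositiveNumeral, binaryValue,
          Symbol.index, Nat.bit]
    · obtain ⟨h, h'⟩ := ih m (by omega) hm
      rw [binary_bit _ _ (by omega)]
      refine ⟨?_, ?_⟩
      · cases hw : binary m with
        | nil => simp [hw, isPositiveNumeral, Symbol.index] at h
        | cons d w =>
          rw [isPositiveNumeral_cons_cons, ← hw, h, decide_eq_true hi]
          rfl
      · rw [binaryValue_cons, h', hv]

/-- The last digit is the most significant one; as it is required to be 1, there are no superfluous
zeros and the value determines the word. -/
theorem binary_binaryValue {w : List Symbol} (hw : isPositiveNumeral w = true) :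
    binary (binaryValue w) = w ∧ 0 < binaryValue w := by
  induction w with
  | nil => simp [isPositiveNumeral, Symbol.index] at hw
  | cons c w ih =>
    cases w with
    | nil => cases c <;> simp_all [isPositiveNumeral, Symbol.index, binaryValue, binary]
    | cons d w =>
      rw [isPositiveNumeral_cons_cons, Bool.and_eq_true, decide_eq_true_iff] at hw
      obtain ⟨h, h'⟩ := ih hw.2
      rw [binaryValue_cons]
      refine ⟨?_, by omega⟩
      generalize binaryValue (d :: w) = v at h h'
      have hv : v + v + c.index = Nat.bit (c.index == 1) v := by
        cases c <;> simp_all [Nat.bit, Symbol.index] <;> omega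
      rw [hv, binary_bit _ _ (by omega), h]
      cases c <;> simp_all [Symbol.index]

/-! ### The decision problem -/

/-- The parser returns something on every word. Comparing the input with the encoding of that result
makes acceptance sound on arbitrary words; completeness uses that the parser inverts the encoding.
-/
theorem accepts_iff {Admissible : EdgeList → Prop} {admissible : RawGraph → Bool}
    (h : ∀ I : EdgeList, admissible I.raw = true ↔ Admissible I) (w : List Symbol) :
    accepts admissible w = true ↔ w ∈ componentProblem Admissible := by
  have hnum : ∀ {b : List Symbol}, isPositiveNumeral b = true → Symbol.semicolon ∉ b := by
    intro b hb hs
    rw [isPositiveNumeral, Bool.and_eq_true, List.all_eq_true] at hb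
    have := hb.1 _ hs
    simp [Symbol.index] at this
  -- A component has at most `n` vertices, so the cap `n + 1` does not change the comparison.
  have hcap : ∀ (g : RawGraph) (b : List Symbol) (v : ℕ),
      cappedValue (g.1 + 1) b ≤ (g.component v).length ↔
        binaryValue b ≤ (g.component v).length := by
    intro g b v
    have : (g.component v).length ≤ g.1 :=
      (List.length_filter_le _ _).trans_eq List.length_range
    rw [cappedValue_eq]
    omega
  simp only [accepts, Bool.and_eq_true, sameWord_iff, List.any_eq_true, decide_eq_true_iff, hcap,
    ← EdgeList.exists_raw_eq_iff]
  constructor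
  -- Here the origin of `b` and `g` is irrelevant: the tests alone show that `w` encodes a
  -- yes-instance.
  · generalize (fields .semicolon w).headD [] = b
    generalize parseGraph (fields .semicolon w).tail = g
    rintro ⟨⟨⟨⟨hb, hw⟩, I, rfl⟩, hI⟩, hv⟩
    obtain ⟨h₁, h₂⟩ := binary_binaryValue hb
    refine ⟨I, binaryValue b, (h I).1 hI, h₂, ?_, (I.exists_isComponent_iff _).2 hv⟩
    rw [encodeInstance, h₁, I.encodeGraph_eq, hw]
  · rintro ⟨I, l, hI, hl, rfl, hS⟩
    obtain ⟨h₁, h₂⟩ := isPositiveNumeral_binary hl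
    have hf : fields .semicolon (encodeInstance I l) =
        binary l :: fields .semicolon (graphWord I.raw) := by
      rw [encodeInstance, I.encodeGraph_eq, fields_append (hnum h₁)]
    rw [hf, List.headD_cons, List.tail_cons, parseGraph_graphWord, h₂]
    exact ⟨⟨⟨⟨h₁, by rw [encodeInstance, I.encodeGraph_eq]⟩, I, rfl⟩, (h I).2 hI⟩,
      (I.exists_isComponent_iff l).1 hS⟩

theorem inP_componentProblem {Admissible : EdgeList → Prop} {admissible : RawGraph → Bool}
    (hp : PolyFun admissible) (h : ∀ I : EdgeList, admissible I.raw = true ↔ Admissible I) :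
    InP (componentProblem Admissible) :=
  (PolyFun.accepts hp).inP (accepts_iff h)

theorem raw_simple (I : EdgeList) :
    (I.raw.loopless && I.raw.noMultipleEdges) = true ↔ I.Simple := by
  rw [Bool.and_eq_true, I.raw_loopless, I.raw_noMultipleEdges, EdgeList.Simple]

end ColorAvoiding

theorem theorem1 :
    -- color-avoiding edge-connectivity is an equivalence relation
    (∀ (V E C : Type*) (G : ColorAvoiding.ColoredGraph V E C),
      Equivalence G.ColorAvoidingConnected) ∧
    -- the decision problem, and its three generalizations, are in P
    ColorAvoiding.InP ColorAvoiding.ColorAvoidingEdgeConnectedComponent ∧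
    ColorAvoiding.InP ColorAvoiding.ColorAvoidingEdgeConnectedComponentMultigraph ∧
    ColorAvoiding.InP ColorAvoiding.ColorAvoidingEdgeConnectedComponentLists ∧
    ColorAvoiding.InP ColorAvoiding.ColorAvoidingEdgeConnectedComponentMultigraphLists ∧
    -- the components can be listed in polynomial time
    (∃ f : (I : ColorAvoiding.EdgeList) → List (List (Fin I.n)),
      (∀ I : ColorAvoiding.EdgeList, I.ListsComponents (f I)) ∧
      ColorAvoiding.PolyTimeComputable ColorAvoiding.encodeGraph ColorAvoiding.encodeLists
        (fun I : ColorAvoiding.EdgeList => (f I).map (fun l => l.map Fin.val))) := by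
  refine ⟨fun V E C G => ColorAvoiding.equivalence_colorAvoidingConnected G, ?_, ?_, ?_, ?_, ?_⟩
  · exact ColorAvoiding.inP_componentProblem
      (admissible := fun g => (g.loopless && g.noMultipleEdges) && g.singleColored) (by fun_prop)
      fun I => by rw [Bool.and_eq_true, ColorAvoiding.raw_simple, I.raw_singleColored]
  · exact ColorAvoiding.inP_componentProblem
      (admissible := fun g => g.loopless && g.singleColored) (by fun_prop)
      fun I => by rw [Bool.and_eq_true, I.raw_loopless, I.raw_singleColored]
  · exact ColorAvoiding.inP_componentProblem
      (admissible := fun g => g.loopless && g.noMultipleEdges) (by fun_prop)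
      fun I => ColorAvoiding.raw_simple I
  · exact ColorAvoiding.inP_componentProblem
      (admissible := fun g => g.loopless) (by fun_prop) fun I => I.raw_loopless
  · refine ⟨fun I => I.components, fun I => I.listsComponents_components, ?_⟩
    -- Only words of graphs occur as inputs here, so the parsed graph needs no validity test.
    have h : ColorAvoiding.PolyFun fun w : List ColorAvoiding.Symbol =>
        ColorAvoiding.encodeLists (ColorAvoiding.RawGraph.components
          (ColorAvoiding.parseGraph (ColorAvoiding.fields .semicolon w))) := by fun_prop
    refine h.polyTimeComputable fun I => ?_
    rw [I.encodeGraph_eq, ColorAvoiding.parseGraph_graphWord, I.raw_components]
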